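/- **Theorem 2.1.** Let $\epsilon$ be a formal parameter, $\Lambda=e^{\epsilon\partial_x}$ (so $\Lambda f(x)=f(x+\epsilon)$, expanded in powers of $\epsilon$), and let $v,u\in C^\infty(\mathbb R)[[\epsilon]]$ (in particular, $v,u$ may be smooth real functions of $x$). Let $$L=\Lambda+v+e^{u}\Lambda^{-1}.$$ Let $\mathcal E$ be the ring of finite sums $\sum_S f_S\,e^{S(x)/\epsilon}$ with $S\in C^\infty(\mathbb R)$, $f_S\in C^\infty(\mathbb R)((\epsilon))$, on which $\partial_x$ and $\Lambda$ act by $$\partial_x\big(f e^{S/\epsilon}\big)=\big(f_x+\epsilon^{-1}S_x f\big)e^{S/\epsilon},\qquad \Lambda\big(f e^{S/\epsilon}\big)=(\Lambda f)\,\exp\Big(\sum_{k\ge0}\tfrac{\epsilon^{k}}{(k+1)!}\partial_x^{k+1}S\Big)e^{S/\epsilon}.$$ Dressing operators of $L$ are formal series $$P=\sum_{k\ge 0}p_k\Lambda^{-k},\quad p_0=1,\qquad Q=\sum_{k\ge 0}q_k\Lambda^{k},\qquad p_k,q_k\in\mathcal E,$$ which are invertible in the rings of Laurent series in $\Lambda^{-1}$,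 respectively in $\Lambda$, with coefficients in $\mathcal E$, and satisfy $$L=P\Lambda P^{-1}=Q\Lambda^{-1}Q^{-1}.$$ Define $$\log L:=\tfrac12\left(P\,\epsilon\partial_x\,P^{-1}-Q\,\epsilon\partial_x\,Q^{-1}\right).$$ Let $\mathcal R$ be the ring of formal power series $\sum_{k\ge0}f_k\epsilon^k$, where each $f_k$ is a polynomial with real coefficients in $v$, $u$, $e^{\pm u}$ and the $x$-derivatives of $v$ and $u$. Then: 1. for all $v,u$, dressing operators of $L$ exist; 2. $\log L$ does not depend on the choice of the dressing operators; 3. there are elements $g_k\in\mathcal R$, $k\in\mathbb Z$, the same for all $v,u$, such that for all $v,u$ $$\log L=\sum_{k\in\mathbb Z}g_k\Lambda^k,\qquad g_k=g_k(v,u,v_x,u_x,v_{xx},u_{xx},\dots;\epsilon);$$ in particular $\partial_x$ cancels in $\log L$. -/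

import Mathlib

open scoped ContDiff

noncomputable section

namespace Toda

/-! ### Smooth functions on the line -/

/-- The algebra `C^∞(ℝ)` of smooth real functions of `x`, as a subalgebra of `ℝ → ℝ`. -/
def smoothSubalgebra : Subalgebra ℝ (ℝ → ℝ) where
  carrier := {f | ContDiff ℝ ∞ f}
  mul_mem' {f g} (hf : ContDiff ℝ ∞ f) (hg : ContDiff ℝ ∞ g) := hf.mul hg
  add_mem' {f g} (hf : ContDiff ℝ ∞ f) (hg : ContDiff ℝ ∞ g) := hf.add hg
  algebraMap_mem' c := (contDiff_const : ContDiff ℝ ∞ fun _ : ℝ => c)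

/-- The algebra `C^∞(ℝ)`, with pointwise operations. -/
def Smooth : Type := smoothSubalgebra

instance : CommRing Smooth := inferInstanceAs (CommRing smoothSubalgebra)

instance : Algebra ℝ Smooth := inferInstanceAs (Algebra ℝ smoothSubalgebra)

theorem Smooth.contDiff (f : Smooth) : ContDiff ℝ ∞ f.1 := f.2

theorem Smooth.differentiable (f : Smooth) : Differentiable ℝ f.1 :=
  f.contDiff.differentiable (by simp)

/-- The derivation `∂ₓ` of `C^∞(ℝ)`. -/
def dx : Smooth →ₗ[ℝ] Smooth where
  toFun f := ⟨deriv f.1, ContDiff.iterate_deriv 1 f.contDiff⟩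
  map_add' f g := Subtype.ext <| funext fun x =>
    deriv_add (f.differentiable x) (g.differentiable x)
  map_smul' c f := Subtype.ext <| funext fun x =>
    deriv_const_smul c (f.differentiable x)

/-- The exponential of a smooth function. -/
def expSmooth (f : Smooth) : Smooth :=
  ⟨fun x => Real.exp (f.1 x), Real.contDiff_exp.comp f.contDiff⟩

/-! ### Formal power series and Laurent series in `ε` -/

/-- `∂ₓ` on `C^∞(ℝ)[[ε]]`, coefficientwise. -/
def dxSeries (f : PowerSeries Smooth) : PowerSeries Smooth :=
  PowerSeries.mk fun n => dx (PowerSeries.coeff n f)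

/-- The exponential `exp(f) = exp(f₀) ∑ₖ (f - f₀)ᵏ / k!` of `f = f₀ + f₁ ε + ⋯ ∈ C^∞(ℝ)[[ε]]`.
The `k`-th term is divisible by `εᵏ`, so only `k ≤ n` contribute to the coefficient of `εⁿ`. -/
def expSeries (f : PowerSeries Smooth) : PowerSeries Smooth :=
  PowerSeries.C (expSmooth (PowerSeries.coeff 0 f)) *
    PowerSeries.mk fun n => ∑ k ∈ Finset.range (n + 1),
      ((k.factorial : ℝ)⁻¹) •
        PowerSeries.coeff n ((f - PowerSeries.C (PowerSeries.coeff 0 f)) ^ k)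

/-- Formal Laurent series `C^∞(ℝ)((ε))`. -/
abbrev Laurent : Type := LaurentSeries Smooth

/-- Scalar multiplication by real numbers on Laurent series is coefficientwise. -/
instance : Algebra ℝ Laurent := HahnSeries.instAlgebra

/-- The inclusion `C^∞(ℝ)[[ε]] ⊆ C^∞(ℝ)((ε))`. -/
def toLaurent (f : PowerSeries Smooth) : Laurent := HahnSeries.ofPowerSeries ℤ Smooth f

/-- The formal parameter `ε`. -/
def eps : Laurent := HahnSeries.single 1 1

/-- `ε⁻¹`. -/
def epsInv : Laurent := HahnSeries.single (-1) 1

/-- `∂ₓ` on `C^∞(ℝ)((ε))`, coefficientwise. -/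
def dxLaurent : Laurent →ₗ[ℝ] Laurent where
  toFun f := f.map dx
  map_add' f g := by ext n; simp
  map_smul' c f := by ext n; simp

theorem shiftCoeff_support (t : ℝ) (f : Laurent) (n : ℤ) :
    (Function.support fun k : ℕ =>
      (t ^ k / (k.factorial : ℝ)) • (dx ^ k) (f.coeff (n - k))).Finite := by
  refine (Set.finite_Iic (n - f.order).toNat).subset fun k hk => ?_
  by_contra h
  apply hk
  have h' : n - k < f.order := by
    simp only [Set.mem_Iic, not_le] at h
    omega
  simp [HahnSeries.coeff_eq_zero_of_lt_order h']

/-- The operator `e^{tε∂ₓ} = ∑ₖ tᵏ εᵏ ∂ₓᵏ / k!` on `C^∞(ℝ)((ε))`,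
that is, `f(x) ↦ f(x + tε)`. -/
def shiftLaurent (t : ℝ) : Laurent →ₗ[ℝ] Laurent where
  toFun f := HahnSeries.ofSuppBddBelow
    (fun n : ℤ => ∑ᶠ k : ℕ, (t ^ k / (k.factorial : ℝ)) • (dx ^ k) (f.coeff (n - k)))
    ⟨f.order, fun n hn => by
      by_contra h
      apply hn
      refine finsum_eq_zero_of_forall_eq_zero fun k => ?_
      have h' : n - k < f.order := by omega
      simp [HahnSeries.coeff_eq_zero_of_lt_order h']⟩
  map_add' f g := by
    ext1
    funext n
    simp only [HahnSeries.coeff_ofSuppBddBelow, HahnSeries.coeff_add, map_add,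
      smul_add]
    exact finsum_add_distrib (shiftCoeff_support t f n) (shiftCoeff_support t g n)
  map_smul' c f := by
    ext1
    funext n
    simp only [HahnSeries.coeff_ofSuppBddBelow, HahnSeries.coeff_smul, map_smul,
      RingHom.id_apply, smul_comm _ c]
    exact (smul_finsum' c (shiftCoeff_support t f n)).symm

/-! ### The ring of coefficients of the dressing operators

The coefficients of dressing operators contain antiderivatives divided by powers of `ε` and
exponentials of such expressions. They live in the ring of finite sums
`∑ f_S(x, ε) e^{S(x)/ε}` with `S ∈ C^∞(ℝ)` and `f_S ∈ C^∞(ℝ)((ε))`; in the group algebra below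
the basis element attached to `S` stands for `e^{S(x)/ε}`. -/

/-- Finite sums `∑ f_S e^{S/ε}`, with `e^{S/ε} e^{T/ε} = e^{(S+T)/ε}`. -/
abbrev Coef : Type := AddMonoidAlgebra Laurent Smooth

/-- `f ∈ C^∞(ℝ)((ε))` as an element of `Coef`. -/
def ofLaurent (f : Laurent) : Coef := AddMonoidAlgebra.single 0 f

/-- `f ∈ C^∞(ℝ)[[ε]]` as an element of `Coef`. -/
def ofSeries (f : PowerSeries Smooth) : Coef := ofLaurent (toLaurent f)

/-- The linear operator `∑ f_S e^{S/ε} ↦ ∑ (g S f_S) e^{S/ε}`. -/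
def diag (g : Smooth → Laurent →ₗ[ℝ] Laurent) : Module.End ℝ Coef :=
  (AddMonoidAlgebra.coeffLinearEquiv ℝ).symm.toLinearMap ∘ₗ
    (Finsupp.lsum ℝ fun S => Finsupp.lsingle S ∘ₗ g S) ∘ₗ
    (AddMonoidAlgebra.coeffLinearEquiv ℝ).toLinearMap

/-- `∂ₓ (f e^{S/ε}) = (∂ₓ f + ε⁻¹ (∂ₓ S) f) e^{S/ε}`. -/
def dxCoef : Module.End ℝ Coef :=
  diag fun S => dxLaurent + LinearMap.mulLeft ℝ (epsInv * toLaurent (PowerSeries.C (dx S)))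

/-- `(S(x + tε) - S(x)) / ε = ∑_{k ≥ 0} t^{k+1} (∂ₓ^{k+1} S) εᵏ / (k+1)!`. -/
def shiftQuot (t : ℝ) (S : Smooth) : PowerSeries Smooth :=
  PowerSeries.mk fun k => (t ^ (k + 1) / ((k + 1).factorial : ℝ)) • (dx ^ (k + 1)) S

/-- `Λᵗ = e^{tε∂ₓ}`, i.e. `x ↦ x + tε`, on `Coef`:
`f(x) e^{S(x)/ε} ↦ f(x + tε) e^{(S(x + tε) - S(x))/ε} e^{S(x)/ε}`. -/
def shift (t : ℝ) : Module.End ℝ Coef :=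
  diag fun S => LinearMap.mulLeft ℝ (toLaurent (expSeries (shiftQuot t S))) ∘ₗ shiftLaurent t

/-! ### Formal operators `∑ₖ Bₖ Λᵏ` -/

/-- Formal series `∑_{k ∈ ℤ} Bₖ Λᵏ`, infinite in both directions. The coefficients `Bₖ` are
linear operators on `Coef`; those that occur are the operators of multiplication by an element
of `Coef`, and compositions of these with `∂ₓ`. -/
abbrev FormalOp : Type := ℤ → Module.End ℝ Coef

/-- Product of formal operators, from `Λⁱ ∘ B = (Λⁱ B Λ⁻ⁱ) ∘ Λⁱ`. It is used only where the sum
is finite, i.e. for two series in `Λ⁻¹` or two series in `Λ` with finitely many terms in the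
other direction. -/
def opMul (A B : FormalOp) : FormalOp := fun n =>
  ∑ᶠ i : ℤ, A i * (shift i * B (n - i) * shift (-i))

/-- The operator of multiplication by an element of `Coef`. -/
def mulOp (f : Coef) : Module.End ℝ Coef := LinearMap.mulLeft ℝ f

/-- `∑ₖ aₖ Λᵏ` with function coefficients `aₖ`. -/
def opOf (a : ℤ → Coef) : FormalOp := fun k => mulOp (a k)

/-- `Λᵐ` as a formal operator. -/
def lam (m : ℤ) : FormalOp := Pi.single m 1

/-- `ε ∂ₓ` as a formal operator (of degree `0` in `Λ`). -/
def epsDx : FormalOp := Pi.single 0 (mulOp (ofLaurent eps) * dxCoef)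

/-- The Lax operator `L = Λ + v + e^u Λ⁻¹`. -/
def lax (v u : PowerSeries Smooth) : FormalOp :=
  lam 1 + Pi.single 0 (mulOp (ofSeries v)) + Pi.single (-1) (mulOp (ofSeries (expSeries u)))

/-- A choice of dressing operators of `L = Λ + v + e^u Λ⁻¹`, together with their inverses:
`P = 1 + ∑_{k ≥ 1} p_k Λ⁻ᵏ` in the ring of Laurent series in `Λ⁻¹`, `Q = ∑_{k ≥ 0} q_k Λᵏ` in the
ring of Laurent series in `Λ`, and `L = P Λ P⁻¹ = Q Λ⁻¹ Q⁻¹`. -/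
structure Dressing (v u : PowerSeries Smooth) where
  /-- `P`, with `p_k` at index `-k`. -/
  P : ℤ → Coef
  /-- `P⁻¹`. -/
  Pinv : ℤ → Coef
  /-- `Q`, with `q_k` at index `k`. -/
  Q : ℤ → Coef
  /-- `Q⁻¹`. -/
  Qinv : ℤ → Coef
  P_pos : ∀ k : ℤ, 0 < k → P k = 0
  P_zero : P 0 = 1
  Pinv_bdd : BddAbove (Function.support Pinv)
  P_mul_inv : opMul (opOf P) (opOf Pinv) = lam 0
  P_inv_mul : opMul (opOf Pinv) (opOf P) = lam 0
  Q_neg : ∀ k : ℤ, k < 0 → Q k = 0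
  Qinv_bdd : BddBelow (Function.support Qinv)
  Q_mul_inv : opMul (opOf Q) (opOf Qinv) = lam 0
  Q_inv_mul : opMul (opOf Qinv) (opOf Q) = lam 0
  lax_eq_P : lax v u = opMul (opMul (opOf P) (lam 1)) (opOf Pinv)
  lax_eq_Q : lax v u = opMul (opMul (opOf Q) (lam (-1))) (opOf Qinv)

/-- `log L = ½ (P ε∂ₓ P⁻¹ - Q ε∂ₓ Q⁻¹)`. -/
def Dressing.log {v u : PowerSeries Smooth} (D : Dressing v u) : FormalOp :=
  (1 / 2 : ℝ) • (opMul (opMul (opOf D.P) epsDx) (opOf D.Pinv)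
    - opMul (opMul (opOf D.Q) epsDx) (opOf D.Qinv))

/-! ### The ring `𝓡` -/

/-- The jet variables `v⁽ᵐ⁾`, `u⁽ᵐ⁾`, `m ≥ 0`. -/
inductive JetVar : Type
  | v (m : ℕ)
  | u (m : ℕ)

/-- Polynomials in `v⁽ᵐ⁾`, `u⁽ᵐ⁾` (`m ≥ 0`) and `e^{±u}`; the Laurent variable stands for `e^u`. -/
abbrev DiffPoly : Type := LaurentPolynomial (MvPolynomial JetVar ℝ)

/-- The ring `𝓡` of formal power series in `ε` with coefficients in `DiffPoly`. -/
abbrev DiffRing : Type := PowerSeries DiffPoly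

/-- The value of a differential polynomial `∑ₖ pₖ(v, u, vₓ, uₓ, …) e^{ku}` at given `v, u`. -/
def evalPoly (v u : PowerSeries Smooth) (F : DiffPoly) : PowerSeries Smooth :=
  F.coeff.sum fun k p =>
    MvPolynomial.aeval (fun
      | JetVar.v m => dxSeries^[m] v
      | JetVar.u m => dxSeries^[m] u) p * expSeries (k • u)

/-- The value `∑ᵢ fᵢ(v, u, vₓ, uₓ, …) εⁱ` of `∑ᵢ fᵢ εⁱ ∈ 𝓡` at given `v, u`, which may themselves
depend on `ε`. -/
def evalRing (v u : PowerSeries Smooth) (g : DiffRing) : PowerSeries Smooth :=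
  PowerSeries.mk fun n => ∑ p ∈ Finset.HasAntidiagonal.antidiagonal n,
    PowerSeries.coeff p.2 (evalPoly v u (PowerSeries.coeff p.1 g))

end Toda

end

noncomputable section

namespace Toda

open PowerSeries Finset

/-! ### Smooth functions -/

/-! Formally log L is the derivative of L^m at m = 0, and the proof makes this precise by
interpolating integer powers. For T = Λ^{±1}, suppose P T⁻¹ S = T⁻¹ + v + wT with S = P⁻¹. Then (T⁻¹
+ v + wT)^m T^m = P (T^{-m} S T^m) for every natural m. The coefficients on the left obey a
recurrence that sums over i < m (`IsPowerCoeff`), so by Faulhaber's formula each of them is, at each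
order of ε, a polynomial in m with differential polynomials as coefficients (`exists_isPowerCoeff`).
On the right T^{-m} acts on the coefficients of S as a shift of x, whose part linear in m is a
multiple of ε∂ₓ. Two polynomials that agree at all natural m have the same linear part, so P(ε∂ₓS)
is given by universal differential polynomials (`conv_epsDx_eq`).

The obstacle is that shifting e^{S(x)/ε} is in general not polynomial in m. It is removed by showing
that only constant exponents occur in the inverse dressing series: its coefficients solve equations
(Λ^{±1} - 1)c = known, and for a nonconstant exponent the homogeneous twisted equation has only the
zero solution (`eq_zero_of_twisted_shift_eq`, `IsInverseDressing.constExp`).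

For P the argument applies directly with T = Λ⁻¹. For Q one first strips off an exponential q =
e^{ℓ/ε} with Λq = e^{Λu}q, which normalizes L to T⁻¹ + v + wT with T = Λ and w = Λe^u. The factors
q/Λⁿq and q ε∂ₓ(q⁻¹) = -∂ₓℓ that reappear are universal as well (`exists_mul_shift_eq_evalRing`,
`exists_dxSeries_eq_evalRing`).

By the Leibniz rule P ε∂ₓ P⁻¹ = ε∂ₓ + P(ε∂ₓP⁻¹), and likewise for Q, so ∂ₓ cancels in the difference
(`Dressing.log_apply`). Independence of the choice follows because the resulting formula does not
mention the dressing operators. Existence rests on the surjectivity of Λ - 1 on Laurent series, that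
is, on antiderivatives (`exists_shiftSeries_sub_eq`). -/

theorem Smooth.ext {f g : Smooth} (h : ∀ x, f.1 x = g.1 x) : f = g := Subtype.ext (funext h)

@[simp] theorem Smooth.val_mul (f g : Smooth) (x : ℝ) : (f * g).1 x = f.1 x * g.1 x := rfl
@[simp] theorem Smooth.val_smul (c : ℝ) (g : Smooth) (x : ℝ) : (c • g).1 x = c * g.1 x := rfl

/-- Evaluation at a point. -/
def evalAt (x : ℝ) : Smooth →ₐ[ℝ] ℝ where
  toFun f := f.1 x
  map_one' := rfl
  map_mul' _ _ := rfl
  map_zero' := rfl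
  map_add' _ _ := rfl
  commutes' _ := rfl

theorem evalAt_apply (x : ℝ) (f : Smooth) : evalAt x f = f.1 x := rfl

theorem dx_mul (f g : Smooth) : dx (f * g) = dx f * g + f * dx g :=
  Smooth.ext fun x => deriv_mul (f.differentiable x) (g.differentiable x)

theorem dx_one : dx (1 : Smooth) = 0 := by
  have h := dx_mul 1 1
  simpa using h

theorem dx_expSmooth (f : Smooth) : dx (expSmooth f) = dx f * expSmooth f :=
  Smooth.ext fun x => by
    have h := ((f.differentiable x).hasDerivAt.exp).deriv
    rw [mul_comm] at h
    exact h

theorem expSmooth_add (f g : Smooth) : expSmooth (f + g) = expSmooth f * expSmooth g :=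
  Smooth.ext fun _ => Real.exp_add _ _

theorem expSmooth_zero : expSmooth 0 = 1 := Smooth.ext fun _ => Real.exp_zero

/-- Smooth functions have smooth antiderivatives. -/
theorem dx_surjective : Function.Surjective dx := by
  intro f
  have hd : ∀ x, HasDerivAt (fun y => ∫ t in (0 : ℝ)..y, f.1 t) (f.1 x) x := fun x =>
    (f.contDiff.continuous.integral_hasStrictDerivAt 0 x).hasDerivAt
  have hde : deriv (fun y => ∫ t in (0 : ℝ)..y, f.1 t) = f.1 := funext fun x => (hd x).deriv
  refine ⟨⟨fun y => ∫ t in (0 : ℝ)..y, f.1 t, ?_⟩, ?_⟩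
  · change ContDiff ℝ ∞ _
    rw [contDiff_infty_iff_deriv, hde]
    exact ⟨fun x => (hd x).differentiableAt, f.contDiff⟩
  · exact Subtype.ext hde

theorem eq_of_dx_eq_zero {f : Smooth} (h : dx f = 0) (x y : ℝ) : f.1 x = f.1 y :=
  is_const_of_deriv_eq_zero f.differentiable (fun z => congrFun (congrArg Subtype.val h) z) x y

/-! ### Power series with smooth coefficients -/

theorem coeff_zero_mul' (f g : PowerSeries Smooth) :
    coeff 0 (f * g) = coeff 0 f * coeff 0 g := by
  simp

@[simp] theorem coeff_dxSeries (n : ℕ) (f : PowerSeries Smooth) :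
    coeff n (dxSeries f) = dx (coeff n f) := coeff_mk _ _

theorem dxSeries_add (f g : PowerSeries Smooth) : dxSeries (f + g) = dxSeries f + dxSeries g := by
  ext1 n; simp

theorem dxSeries_sub (f g : PowerSeries Smooth) : dxSeries (f - g) = dxSeries f - dxSeries g := by
  ext1 n; simp

theorem dxSeries_smul (c : ℝ) (f : PowerSeries Smooth) : dxSeries (c • f) = c • dxSeries f := by
  ext1 n; simp

theorem dxSeries_mul (f g : PowerSeries Smooth) :
    dxSeries (f * g) = dxSeries f * g + f * dxSeries g := by
  ext1 n
  simp [coeff_mul, dx_mul, sum_add_distrib]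

theorem dxSeries_C (f : Smooth) : dxSeries (C f) = C (dx f) := by
  ext1 n
  simp only [coeff_dxSeries, coeff_C]
  split_ifs <;> simp

theorem dxSeries_derivative (f : PowerSeries Smooth) :
    dxSeries (derivative Smooth f) = derivative Smooth (dxSeries f) := by
  ext1 n
  have : (dx ((n : Smooth) + 1)) = 0 := by
    have : ((n : Smooth) + 1) = ((n + 1 : ℕ) : ℝ) • (1 : Smooth) := by
      rw [Nat.cast_smul_eq_nsmul]; simp
    rw [this, map_smul, dx_one, smul_zero]
  simp [coeff_derivative, dx_mul, this]

/-- The operator `e^{tε∂ₓ}` on `C^∞(ℝ)[[ε]]`. -/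
def shiftSeries (t : ℝ) (f : PowerSeries Smooth) : PowerSeries Smooth :=
  mk fun n => ∑ p ∈ antidiagonal n,
    (t ^ p.1 / (p.1.factorial : ℝ)) • (dx ^ p.1) (coeff p.2 f)

theorem coeff_shiftSeries (t : ℝ) (f : PowerSeries Smooth) (n : ℕ) :
    coeff n (shiftSeries t f) = ∑ p ∈ antidiagonal n,
      (t ^ p.1 / (p.1.factorial : ℝ)) • (dx ^ p.1) (coeff p.2 f) := coeff_mk _ _

theorem shiftSeries_add (t : ℝ) (f g : PowerSeries Smooth) :
    shiftSeries t (f + g) = shiftSeries t f + shiftSeries t g := by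
  ext1 n
  simp [coeff_shiftSeries, sum_add_distrib]

theorem shiftSeries_smul (t c : ℝ) (f : PowerSeries Smooth) :
    shiftSeries t (c • f) = c • shiftSeries t f := by
  ext1 n
  simp [coeff_shiftSeries, smul_sum, smul_comm c]

theorem coeff_zero_shiftSeries (t : ℝ) (f : PowerSeries Smooth) :
    coeff 0 (shiftSeries t f) = coeff 0 f := by
  simp [coeff_shiftSeries]

theorem dxSeries_shiftSeries (t : ℝ) (f : PowerSeries Smooth) :
    dxSeries (shiftSeries t f) = shiftSeries t (dxSeries f) := by
  ext1 n
  simp only [coeff_dxSeries, coeff_shiftSeries, map_sum, map_smul]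
  refine sum_congr rfl fun p _ => ?_
  rw [← Module.End.mul_apply, ← Module.End.mul_apply, ← pow_succ, ← pow_succ']

theorem natCast_mul_eq_smul (n : ℕ) (f : Smooth) : f * ((n : Smooth) + 1) = ((n : ℝ) + 1) • f := by
  refine Smooth.ext fun x => ?_
  have : ((n : Smooth) + 1).1 x = (n : ℝ) + 1 := by
    rw [← evalAt_apply]; simp
  rw [Smooth.val_mul, Smooth.val_smul, this, mul_comm]

/-- Chain rule in ε for f(x + tε; ε). It allows identities for the shift to be proved by induction
on the order in ε, since a coefficient of positive degree is determined by the ε-derivative. -/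
theorem derivative_shiftSeries (t : ℝ) (f : PowerSeries Smooth) :
    derivative Smooth (shiftSeries t f)
      = shiftSeries t (derivative Smooth f + t • dxSeries f) := by
  ext1 n
  rw [coeff_derivative, natCast_mul_eq_smul, coeff_shiftSeries, coeff_shiftSeries, smul_sum]
  -- The factor n + 1 is split as p.1 + p.2: the p.2 part differentiates f in ε, and the p.1 part
  -- cancels against the factorial and leaves one extra ∂ₓ.
  have key : ∀ p ∈ antidiagonal (n + 1),
      ((n : ℝ) + 1) • (t ^ p.1 / (p.1.factorial : ℝ)) • (dx ^ p.1) (coeff p.2 f)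
      = ((p.1 : ℝ) * (t ^ p.1 / (p.1.factorial : ℝ))) • (dx ^ p.1) (coeff p.2 f)
        + ((p.2 : ℝ) * (t ^ p.1 / (p.1.factorial : ℝ))) • (dx ^ p.1) (coeff p.2 f) := by
    intro p hp
    have h : (p.1 : ℝ) + p.2 = n + 1 := by exact_mod_cast mem_antidiagonal.1 hp
    rw [← h, smul_smul, add_mul, add_smul]
  rw [sum_congr rfl key, sum_add_distrib, Nat.sum_antidiagonal_succ, Nat.sum_antidiagonal_succ']
  simp only [Nat.cast_zero, zero_mul, zero_smul, zero_add, map_add, smul_add, sum_add_distrib]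
  rw [add_comm]
  congr 1
  · refine sum_congr rfl fun p _ => ?_
    rw [coeff_derivative, natCast_mul_eq_smul, map_smul, smul_smul]
    congr 1
    push_cast
    ring
  · refine sum_congr rfl fun p _ => ?_
    rw [PowerSeries.coeff_smul, map_smul, smul_smul, coeff_dxSeries, ← Module.End.mul_apply,
      ← pow_succ]
    congr 1
    rw [Nat.factorial_succ]
    push_cast
    have : (p.1.factorial : ℝ) ≠ 0 := by positivity
    field_simp
    ring

/-- The coefficients of positive degree are determined by those of the derivative. -/
theorem coeff_succ_eq_of_derivative {f g : PowerSeries Smooth} {n : ℕ}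
    (h : coeff n (derivative Smooth f) = coeff n (derivative Smooth g)) :
    coeff (n + 1) f = coeff (n + 1) g := by
  rw [coeff_derivative, coeff_derivative, natCast_mul_eq_smul, natCast_mul_eq_smul] at h
  exact smul_right_injective Smooth (by positivity : (n : ℝ) + 1 ≠ 0) h

/-- Both d/dε and ∂ₓ are derivations, so the ε-derivatives of the two sides are built from products
of the same shape, to which the induction hypothesis at lower order applies. -/
theorem shiftSeries_mul (t : ℝ) (f g : PowerSeries Smooth) :
    shiftSeries t (f * g) = shiftSeries t f * shiftSeries t g := by
  ext1 n
  induction n using Nat.strong_induction_on generalizing f g with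
  | _ n ih =>
    cases n with
    | zero => simp only [coeff_zero_shiftSeries, coeff_zero_mul']
    | succ n =>
      apply coeff_succ_eq_of_derivative
      have e : derivative Smooth (f * g) + t • dxSeries (f * g)
          = (derivative Smooth f + t • dxSeries f) * g
            + f * (derivative Smooth g + t • dxSeries g) := by
        rw [Derivation.leibniz, dxSeries_mul]
        simp only [smul_eq_mul, add_mul, mul_add, smul_add, mul_smul_comm, smul_mul_assoc]
        ring
      rw [derivative_shiftSeries, e, shiftSeries_add, Derivation.leibniz, derivative_shiftSeries,
        derivative_shiftSeries, map_add, map_add]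
      simp only [smul_eq_mul, coeff_mul]
      have ih' : ∀ a b : PowerSeries Smooth, coeff n (shiftSeries t (a * b))
          = coeff n (shiftSeries t a * shiftSeries t b) := fun a b => ih n (Nat.lt_succ_self n) a b
      rw [ih', ih', add_comm, mul_comm (shiftSeries t (derivative Smooth f + _))]
      simp only [coeff_mul]

theorem shiftSeries_shiftSeries (s t : ℝ) (f : PowerSeries Smooth) :
    shiftSeries s (shiftSeries t f) = shiftSeries (s + t) f := by
  ext1 n
  induction n generalizing f with
  | zero => simp only [coeff_zero_shiftSeries]
  | succ n ih =>
    apply coeff_succ_eq_of_derivative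
    rw [derivative_shiftSeries, derivative_shiftSeries, derivative_shiftSeries,
      dxSeries_shiftSeries, ← shiftSeries_smul, ← shiftSeries_add, ih]
    congr 2
    rw [add_smul]
    ring

theorem shiftSeries_zero (f : PowerSeries Smooth) : shiftSeries 0 f = f := by
  ext1 n
  rw [coeff_shiftSeries, sum_eq_single (0, n)]
  · simp
  · intro p hp hne
    have : p.1 ≠ 0 := fun h => hne (Prod.ext h (by simpa [h] using mem_antidiagonal.1 hp))
    simp [this]
  · simp

theorem dx_pow_one {k : ℕ} (hk : k ≠ 0) : (dx ^ k) (1 : Smooth) = 0 := by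
  obtain ⟨k, rfl⟩ := Nat.exists_eq_succ_of_ne_zero hk
  rw [pow_succ, Module.End.mul_apply, dx_one, map_zero]

theorem shiftSeries_one (t : ℝ) : shiftSeries t 1 = 1 := by
  ext1 n
  rw [coeff_shiftSeries, sum_eq_single (0, n)]
  · simp
  · intro p _ hne
    simp only [coeff_one]
    split_ifs with h
    · have : p.1 ≠ 0 := fun h' => by
        apply hne
        have := mem_antidiagonal.1 ‹p ∈ _›
        exact Prod.ext h' (by simp; omega)
      rw [dx_pow_one this, smul_zero]
    · simp
  · simp

/-! ### The exponential -/

theorem coeff_zero_expSeries (f : PowerSeries Smooth) :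
    coeff 0 (expSeries f) = expSmooth (coeff 0 f) := by
  rw [expSeries, coeff_zero_mul', coeff_zero_C, coeff_mk]
  simp

theorem coeff_pow_eq_zero {g : PowerSeries Smooth} (hg : coeff 0 g = 0) {n k : ℕ} (h : n < k) :
    coeff n (g ^ k) = 0 :=
  PowerSeries.coeff_of_lt_order _ <| by
    have h1 : (1 : ℕ∞) ≤ g.order := by
      rw [← Nat.cast_one]
      exact PowerSeries.nat_le_order g 1 fun i hi => by
        obtain rfl : i = 0 := by omega
        exact hg
    calc (n : ℕ∞) < k := by exact_mod_cast h
      _ ≤ k • g.order := by simpa using mul_le_mul_right h1 (k : ℕ∞)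
      _ ≤ _ := PowerSeries.le_order_pow (φ := g) k

/-- Together with the constant term, this linear equation in ε characterizes the exponential. The
functional equation and the compatibility with ∂ₓ and shifts are all obtained from uniqueness of its
solution. -/
theorem derivative_expSeries (f : PowerSeries Smooth) :
    derivative Smooth (expSeries f) = derivative Smooth f * expSeries f := by
  set g := f - C (coeff 0 f) with hg
  have hg0 : coeff 0 g = 0 := by simp [hg]
  have hd : derivative Smooth f = derivative Smooth g := by simp [hg]
  have hC : derivative Smooth (C (expSmooth (coeff 0 f))) = 0 := derivative_C
  rw [expSeries, Derivation.leibniz, hC, smul_zero, add_zero, smul_eq_mul, mul_left_comm, ← hg]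
  congr 1
  have hY : ∀ n N, n < N → coeff n (mk fun n => ∑ k ∈ range (n + 1),
      ((k.factorial : ℝ)⁻¹) • coeff n (g ^ k))
      = ∑ k ∈ range N, ((k.factorial : ℝ)⁻¹) • coeff n (g ^ k) := by
    intro n N h
    rw [coeff_mk]
    refine sum_subset (range_subset_range.2 h) fun k _ hk => ?_
    rw [coeff_pow_eq_zero hg0 (by simpa using hk), smul_zero]
  ext1 n
  rw [coeff_derivative, hY (n + 1) (n + 2) (by omega), sum_mul, sum_range_succ', hd, coeff_mul]
  have h2 : ∀ p ∈ antidiagonal n, coeff p.1 (derivative Smooth g) * coeff p.2 (mk fun n =>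
      ∑ k ∈ range (n + 1), ((k.factorial : ℝ)⁻¹) • coeff n (g ^ k))
      = ∑ k ∈ range (n + 1), ((k.factorial : ℝ)⁻¹) •
        (coeff p.1 (derivative Smooth g) * coeff p.2 (g ^ k)) := by
    intro p hp
    rw [hY p.2 (n + 1) (by have := mem_antidiagonal.1 hp; omega), mul_sum]
    simp only [mul_smul_comm]
  rw [sum_congr rfl h2, sum_comm]
  have h0 : coeff (n + 1) (g ^ 0) = 0 := by simp [coeff_one]
  rw [h0, smul_zero, zero_mul, add_zero]
  refine sum_congr rfl fun k _ => ?_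
  rw [← smul_sum, ← coeff_mul, smul_mul_assoc, ← coeff_derivative, Derivation.leibniz_pow]
  simp only [Nat.add_sub_cancel, smul_eq_mul]
  rw [map_nsmul, mul_comm (g ^ k), ← Nat.cast_smul_eq_nsmul ℝ, smul_smul, Nat.factorial_succ]
  congr 1
  push_cast
  have : (k.factorial : ℝ) ≠ 0 := by positivity
  field_simp

/-- A linear differential equation has at most one solution with a given constant term. -/
theorem eq_of_derivative_eq_mul {a y z : PowerSeries Smooth}
    (hy : derivative Smooth y = a * y) (hz : derivative Smooth z = a * z)
    (h0 : coeff 0 y = coeff 0 z) : y = z := by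
  ext1 n
  induction n using Nat.strong_induction_on with
  | _ n ih =>
    cases n with
    | zero => exact h0
    | succ n =>
      apply coeff_succ_eq_of_derivative
      rw [hy, hz, coeff_mul, coeff_mul]
      refine sum_congr rfl fun p hp => ?_
      rw [ih p.2 (by have := mem_antidiagonal.1 hp; omega)]

theorem expSeries_add (f g : PowerSeries Smooth) :
    expSeries (f + g) = expSeries f * expSeries g := by
  refine eq_of_derivative_eq_mul (derivative_expSeries _) ?_ ?_
  · rw [Derivation.leibniz, derivative_expSeries, derivative_expSeries, map_add]
    simp only [smul_eq_mul]
    ring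
  · simp only [coeff_zero_expSeries, coeff_zero_mul', map_add, expSmooth_add]

theorem expSeries_zero : expSeries 0 = 1 := by
  refine eq_of_derivative_eq_mul (derivative_expSeries _) ?_ ?_
  · simp
  · simp [coeff_zero_expSeries, expSmooth_zero]

theorem expSeries_mul_neg (f : PowerSeries Smooth) : expSeries f * expSeries (-f) = 1 := by
  rw [← expSeries_add, add_neg_cancel, expSeries_zero]

/-- The difference y of the two sides satisfies dy/dε = (df/dε) y with zero constant term, because
∂ₓ commutes with d/dε; hence it vanishes. -/
theorem dxSeries_expSeries (f : PowerSeries Smooth) :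
    dxSeries (expSeries f) = dxSeries f * expSeries f := by
  rw [← sub_eq_zero]
  refine eq_of_derivative_eq_mul (a := derivative Smooth f) ?_ (z := 0) ?_ ?_
  · rw [map_sub, ← dxSeries_derivative, derivative_expSeries, dxSeries_mul, Derivation.leibniz,
      derivative_expSeries, ← dxSeries_derivative]
    simp only [smul_eq_mul]
    ring
  · simp
  · rw [map_sub, coeff_zero_mul', coeff_dxSeries, coeff_dxSeries, coeff_zero_expSeries,
      dx_expSmooth, sub_self, map_zero]

theorem shiftSeries_expSeries (t : ℝ) (f : PowerSeries Smooth) :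
    shiftSeries t (expSeries f) = expSeries (shiftSeries t f) := by
  refine eq_of_derivative_eq_mul ?_ (derivative_expSeries _) ?_
  · rw [derivative_shiftSeries, derivative_shiftSeries, derivative_expSeries, dxSeries_expSeries,
      ← smul_mul_assoc, ← add_mul, shiftSeries_mul]
  · simp only [coeff_zero_expSeries, coeff_zero_shiftSeries]

/-! ### Laurent series with smooth coefficients -/

theorem toLaurent_add (f g : PowerSeries Smooth) :
    toLaurent (f + g) = toLaurent f + toLaurent g := map_add (HahnSeries.ofPowerSeries ℤ Smooth) f g

theorem toLaurent_sub (f g : PowerSeries Smooth) :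
    toLaurent (f - g) = toLaurent f - toLaurent g := map_sub (HahnSeries.ofPowerSeries ℤ Smooth) f g

theorem toLaurent_mul (f g : PowerSeries Smooth) :
    toLaurent (f * g) = toLaurent f * toLaurent g := map_mul (HahnSeries.ofPowerSeries ℤ Smooth) f g

theorem toLaurent_zero : toLaurent 0 = 0 := map_zero (HahnSeries.ofPowerSeries ℤ Smooth)

theorem toLaurent_one : toLaurent 1 = 1 := map_one (HahnSeries.ofPowerSeries ℤ Smooth)

theorem toLaurent_injective : Function.Injective toLaurent :=
  HahnSeries.ofPowerSeries_injective

theorem toLaurent_coeff (f : PowerSeries Smooth) (n : ℕ) :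
    (toLaurent f).coeff n = coeff n f := HahnSeries.ofPowerSeries_apply_coeff f n

theorem toLaurent_coeff_neg (f : PowerSeries Smooth) {n : ℤ} (h : n < 0) :
    (toLaurent f).coeff n = 0 := by
  refine HahnSeries.embDomain_of_notMem_range ?_
  rintro ⟨m, hm⟩
  have : (m : ℤ) = n := hm
  omega

/-- The power `εⁿ`. -/
def epsPow (n : ℤ) : Laurent := HahnSeries.single n 1

theorem epsPow_coeff_mul (n m : ℤ) (f : Laurent) :
    (epsPow n * f).coeff m = f.coeff (m - n) := by
  rw [epsPow, HahnSeries.coeff_single_mul, one_mul]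

theorem epsPow_mul_epsPow (n m : ℤ) : epsPow n * epsPow m = epsPow (n + m) := by
  rw [epsPow, epsPow, HahnSeries.single_mul_single, one_mul, epsPow]

theorem epsPow_zero : epsPow 0 = 1 := rfl

theorem epsPow_mul_neg (n : ℤ) : epsPow n * epsPow (-n) = 1 := by
  rw [epsPow_mul_epsPow, add_neg_cancel, epsPow_zero]

theorem eps_mul_epsInv : eps * epsInv = 1 := epsPow_mul_neg 1

theorem toLaurent_X : toLaurent X = eps := HahnSeries.ofPowerSeries_X

theorem exists_eq_epsPow_mul (f : Laurent) : ∃ (n : ℤ) (g : PowerSeries Smooth),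
    f = epsPow n * toLaurent g := by
  refine ⟨f.order, f.powerSeriesPart, ?_⟩
  have h := LaurentSeries.ofPowerSeries_powerSeriesPart f
  rw [toLaurent, h]
  change f = epsPow _ * (epsPow _ * f)
  rw [← mul_assoc, epsPow_mul_neg, one_mul]

/-- A Laurent series becomes a power series after multiplication by a high power of `ε`. -/
theorem exists_epsPow_mul_eq (f : Laurent) : ∃ N : ℕ, ∀ n : ℕ, N ≤ n →
    ∃ g : PowerSeries Smooth, epsPow n * f = toLaurent g := by
  obtain ⟨k, g, rfl⟩ := exists_eq_epsPow_mul f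
  refine ⟨(-k).toNat, fun n hn => ⟨X ^ (n + k).toNat * g, ?_⟩⟩
  rw [toLaurent_mul, ← mul_assoc, epsPow_mul_epsPow]
  congr 1
  have : toLaurent (X ^ (n + k).toNat) = HahnSeries.single (((n + k).toNat : ℕ) : ℤ) (1 : Smooth) :=
    HahnSeries.ofPowerSeries_X_pow _
  rw [this, Int.toNat_of_nonneg (by omega), epsPow]

theorem dxLaurent_toLaurent (f : PowerSeries Smooth) :
    dxLaurent (toLaurent f) = toLaurent (dxSeries f) := by
  ext1
  funext n
  change dx ((toLaurent f).coeff n) = _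
  rcases lt_or_ge n 0 with h | h
  · rw [toLaurent_coeff_neg _ h, toLaurent_coeff_neg _ h, map_zero]
  · lift n to ℕ using h
    rw [toLaurent_coeff, toLaurent_coeff, coeff_dxSeries]

theorem dxLaurent_epsPow_mul (n : ℤ) (f : Laurent) :
    dxLaurent (epsPow n * f) = epsPow n * dxLaurent f := by
  ext1
  funext m
  change dx ((epsPow n * f).coeff m) = _
  rw [epsPow_coeff_mul, epsPow_coeff_mul]
  rfl

theorem dxLaurent_mul (f g : Laurent) : dxLaurent (f * g) = dxLaurent f * g + f * dxLaurent g := by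
  obtain ⟨n, f, rfl⟩ := exists_eq_epsPow_mul f
  obtain ⟨m, g, rfl⟩ := exists_eq_epsPow_mul g
  have e : epsPow n * toLaurent f * (epsPow m * toLaurent g)
      = epsPow n * (epsPow m * toLaurent (f * g)) := by rw [toLaurent_mul]; ring
  rw [e]
  simp only [dxLaurent_epsPow_mul, dxLaurent_toLaurent, dxSeries_mul, toLaurent_add]
  simp only [toLaurent_mul]
  ring

theorem coeff_shiftLaurent (t : ℝ) (f : Laurent) (n : ℤ) : (shiftLaurent t f).coeff n
    = ∑ᶠ k : ℕ, (t ^ k / (k.factorial : ℝ)) • (dx ^ k) (f.coeff (n - k)) := rfl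

theorem shiftLaurent_toLaurent (t : ℝ) (f : PowerSeries Smooth) :
    shiftLaurent t (toLaurent f) = toLaurent (shiftSeries t f) := by
  ext1
  funext n
  rw [coeff_shiftLaurent]
  rcases lt_or_ge n 0 with h | h
  · rw [toLaurent_coeff_neg _ h]
    refine finsum_eq_zero_of_forall_eq_zero fun k => ?_
    rw [toLaurent_coeff_neg _ (by omega), map_zero, smul_zero]
  · lift n to ℕ using h
    rw [toLaurent_coeff, coeff_shiftSeries, Nat.sum_antidiagonal_eq_sum_range_succ_mk,
      finsum_eq_sum_of_support_subset (s := range (n + 1))]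
    · refine sum_congr rfl fun k hk => ?_
      have : k ≤ n := by simpa [Nat.lt_succ_iff] using hk
      rw [← Nat.cast_sub this, toLaurent_coeff]
    · intro k hk
      by_contra h
      apply hk
      have : n < k := by simpa using h
      dsimp only
      rw [toLaurent_coeff_neg _ (by omega), map_zero, smul_zero]

theorem shiftLaurent_epsPow_mul (t : ℝ) (n : ℤ) (f : Laurent) :
    shiftLaurent t (epsPow n * f) = epsPow n * shiftLaurent t f := by
  ext1
  funext m
  rw [epsPow_coeff_mul, coeff_shiftLaurent, coeff_shiftLaurent]
  refine finsum_congr fun k => ?_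
  rw [epsPow_coeff_mul, sub_right_comm]

theorem shiftLaurent_mul (t : ℝ) (f g : Laurent) :
    shiftLaurent t (f * g) = shiftLaurent t f * shiftLaurent t g := by
  obtain ⟨n, f, rfl⟩ := exists_eq_epsPow_mul f
  obtain ⟨m, g, rfl⟩ := exists_eq_epsPow_mul g
  have e : epsPow n * toLaurent f * (epsPow m * toLaurent g)
      = epsPow n * (epsPow m * toLaurent (f * g)) := by rw [toLaurent_mul]; ring
  rw [e]
  simp only [shiftLaurent_epsPow_mul, shiftLaurent_toLaurent, shiftSeries_mul]
  rw [toLaurent_mul]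
  ring

theorem shiftLaurent_shiftLaurent (s t : ℝ) (f : Laurent) :
    shiftLaurent s (shiftLaurent t f) = shiftLaurent (s + t) f := by
  obtain ⟨n, f, rfl⟩ := exists_eq_epsPow_mul f
  simp only [shiftLaurent_epsPow_mul, shiftLaurent_toLaurent, shiftSeries_shiftSeries]

theorem shiftLaurent_zero (f : Laurent) : shiftLaurent 0 f = f := by
  obtain ⟨n, f, rfl⟩ := exists_eq_epsPow_mul f
  simp only [shiftLaurent_epsPow_mul, shiftLaurent_toLaurent, shiftSeries_zero]

theorem dxLaurent_shiftLaurent (t : ℝ) (f : Laurent) :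
    dxLaurent (shiftLaurent t f) = shiftLaurent t (dxLaurent f) := by
  obtain ⟨n, f, rfl⟩ := exists_eq_epsPow_mul f
  simp only [shiftLaurent_epsPow_mul, shiftLaurent_toLaurent, dxLaurent_epsPow_mul,
    dxLaurent_toLaurent, dxSeries_shiftSeries]

theorem shiftLaurent_one (t : ℝ) : shiftLaurent t 1 = 1 := by
  rw [← toLaurent_one, shiftLaurent_toLaurent, shiftSeries_one]

/-! ### Difference quotients of the exponents -/

/-- Clears the division by ε in (S(x + tε) - S(x))/ε. Since ε can be cancelled, identities for the
quotient reduce to identities for shifts. -/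
theorem X_mul_shiftQuot (t : ℝ) (S : Smooth) :
    X * shiftQuot t S = shiftSeries t (C S) - C S := by
  ext1 n
  rw [map_sub]
  have h1 : coeff n (shiftSeries t (C S)) = (t ^ n / (n.factorial : ℝ)) • (dx ^ n) S := by
    rw [coeff_shiftSeries, sum_eq_single (n, 0)]
    · simp
    · intro p hp hne
      have : p.2 ≠ 0 := fun h => hne (Prod.ext (by simpa [h] using mem_antidiagonal.1 hp) h)
      rw [coeff_C, if_neg this, map_zero, smul_zero]
    · simp
  rw [h1]
  cases n with
  | zero => simp
  | succ n => rw [coeff_succ_X_mul, shiftQuot, coeff_mk, coeff_C, if_neg (Nat.succ_ne_zero n),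
      sub_zero]

theorem X_mul_injective {f g : PowerSeries Smooth} (h : X * f = X * g) : f = g := by
  ext1 n
  rw [← coeff_succ_X_mul, h, coeff_succ_X_mul]

theorem shiftSeries_X_mul (t : ℝ) (f : PowerSeries Smooth) :
    shiftSeries t (X * f) = X * shiftSeries t f := by
  apply toLaurent_injective
  rw [← shiftLaurent_toLaurent, toLaurent_mul, toLaurent_mul, toLaurent_X]
  exact (shiftLaurent_epsPow_mul t 1 _).trans (by rw [shiftLaurent_toLaurent]; rfl)

theorem dxSeries_X_mul (f : PowerSeries Smooth) : dxSeries (X * f) = X * dxSeries f := by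
  ext1 n
  cases n with
  | zero => simp
  | succ n => rw [coeff_dxSeries, coeff_succ_X_mul, coeff_succ_X_mul, coeff_dxSeries]

theorem shiftSeries_sub (t : ℝ) (f g : PowerSeries Smooth) :
    shiftSeries t (f - g) = shiftSeries t f - shiftSeries t g := by
  rw [eq_sub_iff_add_eq, ← shiftSeries_add, sub_add_cancel]

theorem shiftQuot_add (t : ℝ) (S T : Smooth) :
    shiftQuot t (S + T) = shiftQuot t S + shiftQuot t T := by
  ext1 n
  simp [shiftQuot]

/-- The additive cocycle identity that makes `shift` a one-parameter group on the exponentials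
e^{S/ε}. -/
theorem shiftQuot_shiftQuot (s t : ℝ) (S : Smooth) :
    shiftQuot s S + shiftSeries s (shiftQuot t S) = shiftQuot (s + t) S := by
  apply X_mul_injective
  rw [mul_add, ← shiftSeries_X_mul, X_mul_shiftQuot, X_mul_shiftQuot, X_mul_shiftQuot,
    shiftSeries_sub, shiftSeries_shiftSeries]
  ring

theorem X_mul_dxSeries_shiftQuot (t : ℝ) (S : Smooth) :
    X * dxSeries (shiftQuot t S) = shiftSeries t (C (dx S)) - C (dx S) := by
  rw [← dxSeries_X_mul, X_mul_shiftQuot, dxSeries_sub, dxSeries_shiftSeries, dxSeries_C]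

theorem shiftQuot_of_dx_eq_zero (t : ℝ) {S : Smooth} (h : dx S = 0) : shiftQuot t S = 0 := by
  ext1 n
  rw [shiftQuot, coeff_mk, pow_succ dx, Module.End.mul_apply, h, map_zero, smul_zero, map_zero]

theorem shiftQuot_zero (S : Smooth) : shiftQuot 0 S = 0 := by
  ext1 n
  simp [shiftQuot]

/-! ### The coefficient ring -/

open AddMonoidAlgebra in
theorem coeff_diag (g : Smooth → Laurent →ₗ[ℝ] Laurent) (c : Coef) (S : Smooth) :
    (diag g c).coeff S = g S (c.coeff S) := by
  change (Finsupp.lsum ℝ (fun S => Finsupp.lsingle S ∘ₗ g S) c.coeff) S = _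
  rw [Finsupp.lsum_apply, Finsupp.sum_apply]
  simp only [LinearMap.comp_apply, Finsupp.lsingle_apply]
  rw [Finsupp.sum, sum_eq_single S]
  · simp
  · intro T _ hT
    exact Finsupp.single_eq_of_ne hT.symm
  · intro h
    simp [Finsupp.notMem_support_iff.1 h]

open AddMonoidAlgebra in
theorem diag_single (g : Smooth → Laurent →ₗ[ℝ] Laurent) (S : Smooth) (f : Laurent) :
    diag g (single S f) = single S (g S f) := by
  ext T : 2
  rw [coeff_diag, coeff_single, coeff_single]
  rcases eq_or_ne S T with rfl | h
  · simp
  · rw [Finsupp.single_eq_of_ne h.symm, Finsupp.single_eq_of_ne h.symm, map_zero]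

/-- `f e^{S/ε}`. -/
abbrev mono (S : Smooth) (f : Laurent) : Coef := AddMonoidAlgebra.single S f

theorem mono_mul_mono (S T : Smooth) (f g : Laurent) :
    mono S f * mono T g = mono (S + T) (f * g) := AddMonoidAlgebra.single_mul_single _ _ _ _

theorem shift_mono (t : ℝ) (S : Smooth) (f : Laurent) :
    shift t (mono S f) = mono S (toLaurent (expSeries (shiftQuot t S)) * shiftLaurent t f) :=
  diag_single _ _ _

theorem coeff_shift (t : ℝ) (c : Coef) (S : Smooth) : (shift t c).coeff S
    = toLaurent (expSeries (shiftQuot t S)) * shiftLaurent t (c.coeff S) := coeff_diag _ _ _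

theorem dxCoef_mono (S : Smooth) (f : Laurent) :
    dxCoef (mono S f) = mono S (dxLaurent f + epsInv * toLaurent (C (dx S)) * f) :=
  diag_single _ _ _

theorem coeff_dxCoef (c : Coef) (S : Smooth) : (dxCoef c).coeff S
    = dxLaurent (c.coeff S) + epsInv * toLaurent (C (dx S)) * c.coeff S := coeff_diag _ _ _

theorem shift_mul (t : ℝ) (a b : Coef) : shift t (a * b) = shift t a * shift t b := by
  induction a using AddMonoidAlgebra.induction_linear with
  | zero => simp
  | add a a' ha ha' => rw [add_mul, map_add, ha, ha', map_add, add_mul]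
  | single S f =>
    induction b using AddMonoidAlgebra.induction_linear with
    | zero => simp
    | add a a' ha ha' => rw [mul_add, map_add, ha, ha', map_add, mul_add]
    | single T g =>
      rw [mono_mul_mono, shift_mono, shift_mono, shift_mono, mono_mul_mono, shiftQuot_add,
        expSeries_add, toLaurent_mul, shiftLaurent_mul]
      congr 1
      ring

theorem shift_one (t : ℝ) : shift t 1 = 1 := by
  have h : shiftQuot t 0 = 0 := shiftQuot_of_dx_eq_zero t (map_zero dx)
  change shift t (mono 0 1) = mono 0 1
  rw [shift_mono, h, expSeries_zero, shiftLaurent_one, toLaurent_one, mul_one]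

theorem shift_shift (s t : ℝ) (a : Coef) : shift s (shift t a) = shift (s + t) a := by
  induction a using AddMonoidAlgebra.induction_linear with
  | zero => simp
  | add a a' ha ha' => simp only [map_add, ha, ha']
  | single S f =>
    rw [shift_mono, shift_mono, shift_mono, shiftLaurent_mul, shiftLaurent_toLaurent,
      shiftSeries_expSeries, shiftLaurent_shiftLaurent, ← mul_assoc, ← toLaurent_mul,
      ← expSeries_add, shiftQuot_shiftQuot]

theorem shift_zero (a : Coef) : shift 0 a = a := by
  induction a using AddMonoidAlgebra.induction_linear with
  | zero => simp
  | add a a' ha ha' => simp only [map_add, ha, ha']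
  | single S f =>
    rw [shift_mono, shiftQuot_zero, expSeries_zero, toLaurent_one, one_mul, shiftLaurent_zero]

theorem dxCoef_mul (a b : Coef) : dxCoef (a * b) = dxCoef a * b + a * dxCoef b := by
  induction a using AddMonoidAlgebra.induction_linear with
  | zero => simp
  | add a a' ha ha' => rw [add_mul, map_add, ha, ha', map_add]; ring
  | single S f =>
    induction b using AddMonoidAlgebra.induction_linear with
    | zero => simp
    | add a a' ha ha' => rw [mul_add, map_add, ha, ha', map_add]; ring
    | single T g =>
      rw [mono_mul_mono, dxCoef_mono, dxCoef_mono, dxCoef_mono, mono_mul_mono, mono_mul_mono,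
        ← AddMonoidAlgebra.single_add, dxLaurent_mul, map_add, map_add, toLaurent_add]
      congr 1
      ring

theorem toLaurent_eq_epsInv_mul {f g : PowerSeries Smooth} (h : X * f = g) :
    toLaurent f = epsInv * toLaurent g := by
  rw [← h, toLaurent_mul, toLaurent_X, ← mul_assoc, mul_comm epsInv, eps_mul_epsInv, one_mul]

theorem dxCoef_shift (t : ℝ) (a : Coef) : dxCoef (shift t a) = shift t (dxCoef a) := by
  induction a using AddMonoidAlgebra.induction_linear with
  | zero => simp
  | add a a' ha ha' => simp only [map_add, ha, ha']
  | single S f =>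
    have h : shiftLaurent t (epsInv * toLaurent (C (dx S)) * f)
        = epsInv * toLaurent (shiftSeries t (C (dx S))) * shiftLaurent t f := by
      rw [shiftLaurent_mul, ← shiftLaurent_toLaurent]
      congr 1
      exact shiftLaurent_epsPow_mul t (-1) _
    rw [shift_mono, dxCoef_mono, dxCoef_mono, shift_mono, map_add, h, dxLaurent_mul,
      dxLaurent_toLaurent, dxSeries_expSeries, toLaurent_mul,
      toLaurent_eq_epsInv_mul (X_mul_dxSeries_shiftQuot t S), dxLaurent_shiftLaurent, toLaurent_sub]
    congr 1
    ring

theorem ofSeries_add (f g : PowerSeries Smooth) : ofSeries (f + g) = ofSeries f + ofSeries g := by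
  simp only [ofSeries, ofLaurent, toLaurent_add, AddMonoidAlgebra.single_add]

theorem ofSeries_mul (f g : PowerSeries Smooth) : ofSeries (f * g) = ofSeries f * ofSeries g := by
  simp only [ofSeries, ofLaurent]
  rw [mono_mul_mono, toLaurent_mul, add_zero]

theorem ofSeries_zero : ofSeries 0 = 0 := by
  simp only [ofSeries, ofLaurent, toLaurent_zero, AddMonoidAlgebra.single_zero]

theorem ofSeries_one : ofSeries 1 = 1 := by
  rw [ofSeries, toLaurent_one]; rfl

theorem shift_ofLaurent (t : ℝ) (f : Laurent) :
    shift t (ofLaurent f) = ofLaurent (shiftLaurent t f) := by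
  rw [ofLaurent, shift_mono, shiftQuot_of_dx_eq_zero t (map_zero dx), expSeries_zero,
    toLaurent_one, one_mul, ofLaurent]

theorem shift_ofSeries (t : ℝ) (f : PowerSeries Smooth) :
    shift t (ofSeries f) = ofSeries (shiftSeries t f) := by
  rw [ofSeries, shift_ofLaurent, shiftLaurent_toLaurent, ofSeries]

theorem coeff_mul_ofLaurent (c : Coef) (f : Laurent) (S : Smooth) :
    (c * ofLaurent f).coeff S = c.coeff S * f :=
  AddMonoidAlgebra.coeff_mul_single_zero ..

/-- `ε∂ₓ` on `Coef`. -/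
def epsDxCoef : Module.End ℝ Coef := mulOp (ofLaurent eps) * dxCoef

theorem epsDxCoef_apply (a : Coef) : epsDxCoef a = ofLaurent eps * dxCoef a := rfl

theorem epsDxCoef_mul (a b : Coef) : epsDxCoef (a * b) = epsDxCoef a * b + a * epsDxCoef b := by
  simp only [epsDxCoef_apply, dxCoef_mul]
  ring

theorem shiftLaurent_eps (t : ℝ) : shiftLaurent t eps = eps := by
  have := shiftLaurent_epsPow_mul t 1 1
  rw [shiftLaurent_one, mul_one] at this
  exact this

theorem epsDxCoef_shift (t : ℝ) (a : Coef) : epsDxCoef (shift t a) = shift t (epsDxCoef a) := by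
  rw [epsDxCoef_apply, epsDxCoef_apply, shift_mul, shift_ofLaurent, shiftLaurent_eps, dxCoef_shift]

theorem coeff_epsDxCoef (c : Coef) (S : Smooth) : (epsDxCoef c).coeff S
    = eps * dxLaurent (c.coeff S) + toLaurent (C (dx S)) * c.coeff S := by
  rw [epsDxCoef_apply, mul_comm, coeff_mul_ofLaurent, coeff_dxCoef, add_mul]
  congr 1
  · ring
  · rw [mul_comm epsInv, mul_assoc, mul_assoc, mul_comm epsInv, mul_assoc, eps_mul_epsInv, mul_one]

/-! ### The kernel and the image of `Λ - 1` -/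

theorem coeff_zero_shiftQuot (t : ℝ) (S : Smooth) : coeff 0 (shiftQuot t S) = t • dx S := by
  rw [shiftQuot, coeff_mk]
  simp

theorem coeff_one_shiftQuot (t : ℝ) (S : Smooth) :
    coeff 1 (shiftQuot t S) = (t ^ 2 / 2) • dx (dx S) := by
  rw [shiftQuot, coeff_mk]
  simp [pow_succ]

theorem coeff_one_expSeries (f : PowerSeries Smooth) :
    coeff 1 (expSeries f) = coeff 1 f * expSmooth (coeff 0 f) := by
  have h := congrArg (coeff 0) (derivative_expSeries f)
  rw [coeff_zero_mul', coeff_derivative, coeff_derivative, coeff_zero_expSeries] at h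
  simpa using h

theorem coeff_one_shiftSeries (t : ℝ) (f : PowerSeries Smooth) :
    coeff 1 (shiftSeries t f) = coeff 1 f + t • dx (coeff 0 f) := by
  rw [coeff_shiftSeries, Nat.sum_antidiagonal_succ]
  simp

theorem coeff_one_mul' (f g : PowerSeries Smooth) :
    coeff 1 (f * g) = coeff 0 f * coeff 1 g + coeff 1 f * coeff 0 g := by
  rw [coeff_mul, Nat.sum_antidiagonal_succ]
  simp

/-- Smooth functions have zero divisors, so order ε⁰, which says that f₀S' = 0, does not suffice.
Differentiating gives f₀'S' + f₀S'' = 0, and f₀S'' vanishes everywhere: trivially where f₀ = 0, and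
where S' = 0 by this relation. Where S' ≠ 0 it follows that f₀' = 0; where S' = 0 the equation at
order ε¹ gives the same. Thus f₀ is constant, and a nonzero constant would force S' = 0 identically.
-/
theorem coeff_zero_eq_zero_of_twisted_shift_eq {t : ℝ} (ht : t ≠ 0) {S : Smooth} (hS : dx S ≠ 0)
    {g : PowerSeries Smooth} (h : expSeries (shiftQuot t S) * shiftSeries t g = g) :
    coeff 0 g = 0 := by
  set f₀ := coeff 0 g with hf₀
  set f₁ := coeff 1 g with hf₁
  have h0 := congrArg (coeff 0) h
  have h1 := congrArg (coeff 1) h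
  rw [coeff_zero_mul', coeff_zero_expSeries, coeff_zero_shiftQuot, coeff_zero_shiftSeries] at h0
  rw [coeff_one_mul', coeff_zero_expSeries, coeff_zero_shiftQuot, coeff_one_shiftSeries,
    coeff_one_expSeries, coeff_zero_shiftSeries, coeff_zero_shiftQuot, coeff_one_shiftQuot] at h1
  rw [← hf₀] at h0 h1
  rw [← hf₁] at h1
  have e0 : ∀ x, f₀.1 x = 0 ∨ (dx S).1 x = 0 := by
    intro x
    have h : Real.exp (t * (dx S).1 x) * f₀.1 x = f₀.1 x :=
      congrFun (congrArg Subtype.val h0) x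
    by_cases hx : f₀.1 x = 0
    · exact Or.inl hx
    · right
      have h' : Real.exp (t * (dx S).1 x) = 1 := mul_right_cancel₀ hx (by rw [h, one_mul])
      rw [Real.exp_eq_one_iff] at h'
      exact (mul_eq_zero.1 h').resolve_left ht
  have p0 : f₀ * dx S = 0 := Smooth.ext fun x => mul_eq_zero.2 (e0 x)
  have p1 : ∀ x, (dx f₀).1 x * (dx S).1 x + f₀.1 x * (dx (dx S)).1 x = 0 := by
    intro x
    have h := congrArg dx p0
    rw [dx_mul, map_zero] at h
    exact congrFun (congrArg Subtype.val h) x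
  have p2 : ∀ x, f₀.1 x * (dx (dx S)).1 x = 0 := by
    intro x
    rcases e0 x with h | h
    · rw [h, zero_mul]
    · simpa [h] using p1 x
  have p3 : dx f₀ = 0 := by
    refine Smooth.ext fun x => ?_
    have h : Real.exp (t * (dx S).1 x) * (f₁.1 x + t * (dx f₀).1 x)
        + t ^ 2 / 2 * (dx (dx S)).1 x * Real.exp (t * (dx S).1 x) * f₀.1 x = f₁.1 x :=
      congrFun (congrArg Subtype.val h1) x
    by_cases hx : (dx S).1 x = 0
    · rw [hx, mul_zero, Real.exp_zero] at h
      have : t * (dx f₀).1 x = 0 := by linear_combination h - t ^ 2 / 2 * p2 x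
      exact (mul_eq_zero.1 this).resolve_left ht
    · have : (dx f₀).1 x * (dx S).1 x = 0 := by linear_combination p1 x - p2 x
      exact (mul_eq_zero.1 this).resolve_right hx
  by_contra hne
  apply hS
  obtain ⟨y, hy⟩ : ∃ y, f₀.1 y ≠ 0 := by
    by_contra! hall
    exact hne (Smooth.ext hall)
  refine Smooth.ext fun x => (e0 x).resolve_left ?_
  rwa [eq_of_dx_eq_zero p3 x y]

theorem epsPow_mul_injective (n : ℤ) {f g : Laurent} (h : epsPow n * f = epsPow n * g) : f = g := by
  rw [← one_mul f, ← one_mul g, ← epsPow_mul_neg n, mul_comm (epsPow n), mul_assoc, mul_assoc, h]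

/-- The equation commutes with multiplication by powers of ε, so once the leading coefficient
vanishes a factor ε can be removed and the argument repeated. -/
theorem eq_zero_of_twisted_shift_eq {t : ℝ} (ht : t ≠ 0) {S : Smooth} (hS : dx S ≠ 0)
    {f : Laurent} (h : toLaurent (expSeries (shiftQuot t S)) * shiftLaurent t f = f) : f = 0 := by
  have key : ∀ n, ∀ g : PowerSeries Smooth, expSeries (shiftQuot t S) * shiftSeries t g = g →
      coeff n g = 0 := by
    intro n
    induction n with
    | zero => exact fun g hg => coeff_zero_eq_zero_of_twisted_shift_eq ht hS hg
    | succ n ih =>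
      intro g hg
      have h0 := coeff_zero_eq_zero_of_twisted_shift_eq ht hS hg
      obtain ⟨g', rfl⟩ := X_dvd_iff.2 ((coeff_zero_eq_constantCoeff_apply g).symm.trans h0)
      rw [coeff_succ_X_mul]
      apply ih
      apply X_mul_injective
      rw [mul_left_comm, ← shiftSeries_X_mul, hg]
  obtain ⟨n, g, rfl⟩ := exists_eq_epsPow_mul f
  have hg : expSeries (shiftQuot t S) * shiftSeries t g = g := by
    apply toLaurent_injective
    rw [shiftLaurent_epsPow_mul, shiftLaurent_toLaurent, mul_left_comm, ← toLaurent_mul] at h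
    exact epsPow_mul_injective n h
  have : g = 0 := by
    ext1 m
    rw [key m g hg, map_zero]
  rw [this, toLaurent_zero, mul_zero]

/-- The elements `∑ f_S e^{S/ε}` of `Coef` in which only constants `S` occur. -/
def ConstExp (c : Coef) : Prop := ∀ S, dx S ≠ 0 → c.coeff S = 0

theorem ConstExp.of_shift_sub {t : ℝ} (ht : t ≠ 0) {c : Coef} (h : ConstExp (shift t c - c)) :
    ConstExp c := by
  intro S hS
  have h' : (shift t c).coeff S - c.coeff S = 0 := h S hS
  rw [coeff_shift, sub_eq_zero] at h'
  exact eq_zero_of_twisted_shift_eq ht hS h'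

theorem constExp_zero : ConstExp 0 := fun _ _ => rfl

theorem ConstExp.add {c d : Coef} (hc : ConstExp c) (hd : ConstExp d) : ConstExp (c + d) :=
  fun S hS => by
    change c.coeff S + d.coeff S = 0
    rw [hc S hS, hd S hS, add_zero]

theorem ConstExp.mul_ofSeries {c : Coef} (hc : ConstExp c) (f : PowerSeries Smooth) :
    ConstExp (c * ofSeries f) := fun S hS => by
  rw [ofSeries, coeff_mul_ofLaurent, hc S hS, zero_mul]

/-- Recursive definitions in which every term depends on all the previous ones. -/
theorem exists_strongRec {α : Type*} (F : ∀ n : ℕ, (∀ m < n, α) → α) :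
    ∃ a : ℕ → α, ∀ n, a n = F n fun m _ => a m :=
  ⟨fun n => Nat.strongRecOn n F, fun n => Nat.strongRecOn_eq F n⟩

theorem sum_antidiagonal_eq_add_sum_fin {M : Type*} [AddCommMonoid M] (f : ℕ → ℕ → M) (n : ℕ) :
    ∑ p ∈ antidiagonal n, f p.1 p.2 = f 0 n + ∑ j : Fin n, f (n - j) j := by
  rw [← Nat.sum_antidiagonal_swap, Nat.sum_antidiagonal_eq_sum_range_succ_mk, sum_range_succ, add_comm,
    Fin.sum_univ_eq_sum_range (fun j => f (n - j) j)]
  simp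

/-- Λ - 1 = ε∂ₓ(1 + ε∂ₓ/2! + ε²∂ₓ²/3! + ⋯). At order n + 1 the outer ∂ₓ is undone by an
antiderivative, and the series in brackets is inverted recursively. -/
theorem exists_shiftSeries_sub_eq (g : PowerSeries Smooth) :
    ∃ f, shiftSeries 1 f - f = X * g := by
  choose A hA using dx_surjective
  -- The new unknown aₙ enters ∑ ∂ₓⁱaⱼ/(i+1)!, i + j = n, with coefficient 1; the remaining terms
  -- involve only earlier aⱼ.
  obtain ⟨a, ha⟩ := exists_strongRec (α := Smooth) fun n prev => A (coeff n g) -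
    ∑ j : Fin n, (((n - j + 1).factorial : ℝ)⁻¹) • (dx ^ (n - j : ℕ)) (prev j j.2)
  refine ⟨mk a, ?_⟩
  ext1 n
  rw [map_sub]
  cases n with
  | zero => rw [coeff_zero_shiftSeries, sub_self, coeff_zero_mul']; simp
  | succ n =>
    rw [coeff_succ_X_mul, coeff_shiftSeries, Nat.sum_antidiagonal_succ]
    have key : ∑ p ∈ antidiagonal n, (((p.1 + 1).factorial : ℝ)⁻¹) • (dx ^ p.1) (a p.2)
        = A (coeff n g) := by
      rw [sum_antidiagonal_eq_add_sum_fin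
        (fun i j => (((i + 1).factorial : ℝ)⁻¹) • (dx ^ i) (a j)) n]
      conv_lhs => rw [show a n = _ from ha n]
      simp
    have key' := congrArg dx key
    rw [hA, map_sum] at key'
    rw [← key']
    simp [pow_succ']

theorem exists_shiftLaurent_one_sub_eq (g : Laurent) : ∃ f, shiftLaurent 1 f - f = g := by
  obtain ⟨n, g, rfl⟩ := exists_eq_epsPow_mul g
  obtain ⟨f, hf⟩ := exists_shiftSeries_sub_eq g
  -- One power of ε is lost because Λ - 1 is divisible by ε.
  refine ⟨epsPow (n - 1) * toLaurent f, ?_⟩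
  rw [shiftLaurent_epsPow_mul, shiftLaurent_toLaurent, ← mul_sub, ← toLaurent_sub, hf,
    toLaurent_mul, toLaurent_X, ← mul_assoc]
  congr 1
  exact (epsPow_mul_epsPow (n - 1) 1).trans (by rw [sub_add_cancel])

/-- Follows from Λ⁻¹ - 1 = -Λ⁻¹(Λ - 1). -/
theorem exists_shiftLaurent_neg_one_sub_eq (g : Laurent) : ∃ f, shiftLaurent (-1) f - f = g := by
  obtain ⟨f, hf⟩ := exists_shiftLaurent_one_sub_eq (shiftLaurent 1 (-g))
  refine ⟨f, ?_⟩
  have := congrArg (shiftLaurent (-1)) hf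
  rw [map_sub, shiftLaurent_shiftLaurent, shiftLaurent_shiftLaurent, neg_add_cancel,
    shiftLaurent_zero, shiftLaurent_zero] at this
  rw [← neg_sub, this, neg_neg]

/-! ### Twisted Laurent series -/

/-- Product of the series `∑ aₖ Tᵏ` and `∑ bₖ Tᵏ`, where `T = Λᵗ`. -/
def conv (t : ℝ) (a b : ℤ → Coef) : ℤ → Coef := fun n =>
  ∑ᶠ i : ℤ, a i * shift (t * i) (b (n - i))

/-- The sequence `a` vanishes at indices smaller than `N`. -/
def VanishBelow (a : ℤ → Coef) (N : ℤ) : Prop := ∀ k < N, a k = 0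

section

variable {t : ℝ} {a b c : ℤ → Coef} {A B D : ℤ}

theorem conv_eq_sum_Icc (ha : VanishBelow a A) (hb : VanishBelow b B) (n : ℤ) :
    conv t a b n = ∑ i ∈ Icc A (n - B), a i * shift (t * i) (b (n - i)) := by
  refine finsum_eq_sum_of_support_subset _ fun i hi => ?_
  rw [coe_Icc]
  by_contra h
  apply hi
  dsimp only
  rw [Set.mem_Icc, not_and_or, not_le, not_le] at h
  rcases h with h | h
  · rw [ha i h, zero_mul]
  · rw [hb (n - i) (by omega), map_zero, mul_zero]

theorem VanishBelow.conv (ha : VanishBelow a A) (hb : VanishBelow b B) :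
    VanishBelow (conv t a b) (A + B) := fun k hk => by
  rw [conv_eq_sum_Icc ha hb, Icc_eq_empty (by omega), sum_empty]

theorem conv_assoc (ha : VanishBelow a A) (hb : VanishBelow b B) (hc : VanishBelow c D) :
    conv t (conv t a b) c = conv t a (conv t b c) := by
  funext n
  rw [conv_eq_sum_Icc (ha.conv hb) hc, conv_eq_sum_Icc ha (hb.conv hc)]
  simp only [conv_eq_sum_Icc ha hb, conv_eq_sum_Icc hb hc, sum_mul, map_sum, mul_sum]
  rw [sum_sigma', sum_sigma']
  -- On the left l is the total degree of the first two factors and i the degree of the first; on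
  -- the right the two indices are the degrees of the first and second factors.
  refine sum_nbij' (fun x => ⟨x.2, x.1 - x.2⟩) (fun x => ⟨x.1 + x.2, x.1⟩) ?_ ?_ ?_ ?_ ?_
  · rintro ⟨l, i⟩ h
    simp only [mem_sigma, mem_Icc] at h ⊢
    omega
  · rintro ⟨i, j⟩ h
    simp only [mem_sigma, mem_Icc] at h ⊢
    omega
  · rintro ⟨l, i⟩ _
    simp
  · rintro ⟨i, j⟩ _
    simp
  · rintro ⟨l, i⟩ _
    dsimp only
    have e1 : n - i - (l - i) = n - l := by ring
    have e2 : t * i + t * ((l - i : ℤ) : ℝ) = t * l := by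
      push_cast
      ring
    rw [shift_mul, shift_shift, mul_assoc, e1, e2]

theorem conv_single_left (m : ℤ) (x : Coef) (b : ℤ → Coef) (n : ℤ) :
    conv t (Pi.single m x) b n = x * shift (t * m) (b (n - m)) := by
  rw [conv, finsum_eq_single _ m, Pi.single_eq_same]
  intro i hi
  rw [Pi.single_eq_of_ne hi, zero_mul]

theorem conv_single_right (a : ℤ → Coef) (m : ℤ) (x : Coef) (n : ℤ) :
    conv t a (Pi.single m x) n = a (n - m) * shift (t * (n - m)) x := by
  rw [conv, finsum_eq_single _ (n - m)]
  · rw [sub_sub_cancel, Pi.single_eq_same]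
    push_cast
    rfl
  · intro i hi
    rw [Pi.single_eq_of_ne (by omega), map_zero, mul_zero]

theorem vanishBelow_single (m : ℤ) (x : Coef) : VanishBelow (Pi.single m x) m := fun _ hk =>
  Pi.single_eq_of_ne hk.ne _

theorem one_conv (a : ℤ → Coef) : conv t (Pi.single 0 1) a = a := by
  funext n
  rw [conv_single_left, one_mul, Int.cast_zero, mul_zero, shift_zero, sub_zero]

theorem conv_one (a : ℤ → Coef) : conv t a (Pi.single 0 1) = a := by
  funext n
  rw [conv_single_right, shift_one, mul_one, sub_zero]

/-- `x T⁻¹ + y + z T`. -/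
def laxSeq (x y z : Coef) : ℤ → Coef := Pi.single (-1) x + Pi.single 0 y + Pi.single 1 z

theorem vanishBelow_laxSeq (x y z : Coef) : VanishBelow (laxSeq x y z) (-1) := by
  intro k hk
  simp only [laxSeq, Pi.add_apply]
  rw [Pi.single_eq_of_ne (by omega), Pi.single_eq_of_ne (by omega), Pi.single_eq_of_ne (by omega)]
  simp

theorem conv_add (ha : VanishBelow a A) (hb : VanishBelow b B) (hc : VanishBelow c B) :
    conv t a (b + c) = conv t a b + conv t a c := by
  funext n
  have hbc : VanishBelow (b + c) B := fun k hk => by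
    rw [Pi.add_apply, hb k hk, hc k hk, add_zero]
  rw [Pi.add_apply, conv_eq_sum_Icc ha hbc, conv_eq_sum_Icc ha hb, conv_eq_sum_Icc ha hc,
    ← sum_add_distrib]
  simp only [Pi.add_apply, map_add, mul_add]

theorem add_conv (ha : VanishBelow a A) (hb : VanishBelow b A) (hc : VanishBelow c B) :
    conv t (a + b) c = conv t a c + conv t b c := by
  funext n
  have hab : VanishBelow (a + b) A := fun k hk => by
    rw [Pi.add_apply, ha k hk, hb k hk, add_zero]
  rw [Pi.add_apply, conv_eq_sum_Icc hab hc, conv_eq_sum_Icc ha hc, conv_eq_sum_Icc hb hc,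
    ← sum_add_distrib]
  simp only [Pi.add_apply, add_mul]

theorem VanishBelow.mono (ha : VanishBelow a A) (h : B ≤ A) : VanishBelow a B := fun k hk =>
  ha k (lt_of_lt_of_le hk h)

theorem VanishBelow.add (ha : VanishBelow a A) (hb : VanishBelow b A) :
    VanishBelow (a + b) A := fun k hk => by
  rw [Pi.add_apply, ha k hk, hb k hk, add_zero]

theorem conv_laxSeq (ha : VanishBelow a A) (x y z : Coef) (n : ℤ) :
    conv t a (laxSeq x y z) n = a (n + 1) * shift (t * (n + 1)) x + a n * shift (t * n) y
      + a (n - 1) * shift (t * (n - 1)) z := by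
  have h1 := vanishBelow_single (-1) x
  have h2 := (vanishBelow_single 0 y).mono (B := -1) (by omega)
  have h3 := (vanishBelow_single 1 z).mono (B := -1) (by omega)
  rw [laxSeq, conv_add ha (h1.add h2) h3, conv_add ha h1 h2, Pi.add_apply, Pi.add_apply,
    conv_single_right, conv_single_right, conv_single_right]
  simp

theorem laxSeq_conv (ha : VanishBelow a A) (x y z : Coef) (n : ℤ) :
    conv t (laxSeq x y z) a n = x * shift (-t) (a (n + 1)) + y * a n
      + z * shift t (a (n - 1)) := by
  have h1 := vanishBelow_single (-1) x
  have h2 := (vanishBelow_single 0 y).mono (B := -1) (by omega)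
  have h3 := (vanishBelow_single 1 z).mono (B := -1) (by omega)
  rw [laxSeq, add_conv (h1.add h2) h3 ha, add_conv h1 h2 ha, Pi.add_apply, Pi.add_apply,
    conv_single_left, conv_single_left, conv_single_left]
  simp [shift_zero]

/-! ### Inverses -/

/-- Extension of a sequence by zero to negative indices. -/
def extendZero (α : ℕ → Coef) : ℤ → Coef := fun k => if 0 ≤ k then α k.toNat else 0

theorem extendZero_natCast (α : ℕ → Coef) (n : ℕ) : extendZero α n = α n := by
  simp [extendZero]

theorem vanishBelow_extendZero (α : ℕ → Coef) : VanishBelow (extendZero α) 0 := fun k hk => by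
  rw [extendZero, if_neg (by omega)]

theorem conv_natCast (ha : VanishBelow a 0) (hb : VanishBelow b 0) (n : ℕ) :
    conv t a b n = ∑ p ∈ antidiagonal n, a p.1 * shift (t * p.1) (b p.2) := by
  rw [Nat.sum_antidiagonal_eq_sum_range_succ_mk, conv_eq_sum_Icc ha hb]
  refine sum_nbij' Int.toNat (fun i : ℕ => (i : ℤ)) ?_ ?_ ?_ ?_ ?_
  · intro i hi
    simp only [mem_Icc, mem_range] at hi ⊢
    omega
  · intro i hi
    simp only [mem_Icc, mem_range] at hi ⊢
    omega
  · intro i hi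
    simp only [mem_Icc] at hi
    exact Int.toNat_of_nonneg hi.1
  · intro i _
    simp
  · intro i hi
    simp only [mem_Icc] at hi
    lift i to ℕ using hi.1
    have : i ≤ n := by omega
    simp [Nat.cast_sub this]

theorem exists_right_inverse (ha : VanishBelow a 0) {x : Coef} (hx : a 0 * x = 1) :
    ∃ b, VanishBelow b 0 ∧ b 0 = x ∧ conv t a b = Pi.single 0 1 := by
  -- The system is triangular: the coefficient of βₙ in degree n is a₀, whose inverse is x.
  obtain ⟨β, hβ⟩ := exists_strongRec (α := Coef) fun n prev => x * ((if n = 0 then 1 else 0) -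
    ∑ j : Fin n, a (n - j : ℕ) * shift (t * (n - j : ℕ)) (prev j j.2))
  refine ⟨extendZero β, vanishBelow_extendZero β, ?_, ?_⟩
  · have h : extendZero β 0 = β 0 := extendZero_natCast β 0
    rw [h, hβ 0]
    simp
  · funext n
    rcases lt_or_ge n 0 with h | h
    · rw [(ha.conv (vanishBelow_extendZero β)) n (by simpa using h), Pi.single_eq_of_ne h.ne]
    · lift n to ℕ using h
      rw [conv_natCast ha (vanishBelow_extendZero β)]
      simp only [extendZero_natCast]
      rw [sum_antidiagonal_eq_add_sum_fin (fun i j => a i * shift (t * i) (β j)) n]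
      conv_lhs => rw [hβ n]
      simp only [Nat.cast_zero, mul_zero, shift_zero]
      rw [← mul_assoc, hx, one_mul, sub_add_cancel]
      rcases eq_or_ne n 0 with rfl | hn
      · simp
      · rw [if_neg hn, Pi.single_eq_of_ne (by exact_mod_cast hn)]

/-- A twisted power series with invertible constant term is invertible. -/
theorem exists_inverse (ha : VanishBelow a 0) {x : Coef} (hx : a 0 * x = 1) :
    ∃ b, VanishBelow b 0 ∧ conv t a b = Pi.single 0 1 ∧ conv t b a = Pi.single 0 1 := by
  obtain ⟨b, hb, hb0, hab⟩ := exists_right_inverse (t := t) ha hx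
  obtain ⟨d, hd, -, hbd⟩ := exists_right_inverse (t := t) hb (x := a 0) (by rw [hb0, mul_comm, hx])
  have : a = d := by
    rw [← conv_one (t := t) a, ← hbd, ← conv_assoc ha hb hd, hab, one_conv]
  exact ⟨b, hb, hab, by rw [this, hbd]⟩

/-! ### Formal operators -/

theorem mulOp_mul (f g : Coef) : mulOp (f * g) = mulOp f * mulOp g :=
  LinearMap.ext fun _ => mul_assoc _ _ _

theorem mulOp_apply (f g : Coef) : mulOp f g = f * g := rfl

theorem mulOp_injective : Function.Injective mulOp := fun f g h => by
  have := LinearMap.congr_fun h 1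
  rwa [mulOp_apply, mulOp_apply, mul_one, mul_one] at this

/-- `mulOp` as an additive homomorphism. -/
def mulOpHom : Coef →+ Module.End ℝ Coef where
  toFun := mulOp
  map_zero' := LinearMap.ext fun _ => zero_mul _
  map_add' _ _ := LinearMap.ext fun _ => add_mul _ _ _

theorem mulOp_one : mulOp 1 = 1 := LinearMap.ext fun _ => one_mul _

theorem mulOp_zero : mulOp 0 = 0 := map_zero mulOpHom

theorem shift_mul_mulOp (s : ℝ) (f : Coef) : shift s * mulOp f = mulOp (shift s f) * shift s :=
  LinearMap.ext fun g => shift_mul s f g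

theorem shift_mul_shift_neg (s : ℝ) : shift s * shift (-s) = 1 := LinearMap.ext fun g => by
  rw [Module.End.mul_apply, shift_shift, add_neg_cancel, shift_zero, Module.End.one_apply]

theorem opOf_injective : Function.Injective opOf := fun _ _ h =>
  funext fun k => mulOp_injective (congrFun h k)

theorem opOf_single (m : ℤ) (x : Coef) : opOf (Pi.single m x) = Pi.single m (mulOp x) := by
  funext k
  rcases eq_or_ne k m with rfl | h
  · simp [opOf]
  · simp [opOf, Pi.single_eq_of_ne h, mulOp_zero]

theorem lam_eq_opOf (m : ℤ) : lam m = opOf (Pi.single m 1) := by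
  rw [opOf_single, mulOp_one, lam]

/-- Λⁱ ∘ f ∘ Λ⁻ⁱ is multiplication by Λⁱf. No finiteness is needed, since `mulOp` is injective and
so the two `finsum`s have the same support. -/
theorem opMul_opOf (a b : ℤ → Coef) : opMul (opOf a) (opOf b) = opOf (conv 1 a b) := by
  funext n
  have h := AddMonoidHom.map_finsum_of_injective mulOpHom mulOp_injective
    (fun i : ℤ => a i * shift (1 * (i : ℝ)) (b (n - i)))
  refine Eq.trans (finsum_congr fun i => ?_) h.symm
  change mulOp (a i) * (shift i * mulOp (b (n - i)) * shift (-i)) = mulOp _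
  rw [shift_mul_mulOp, mul_assoc (mulOp _), shift_mul_shift_neg, mul_one, mulOp_mul, one_mul]

theorem lax_eq_opOf (v u : PowerSeries Smooth) :
    lax v u = opOf (laxSeq (ofSeries (expSeries u)) (ofSeries v) 1) := by
  have hadd : ∀ a b : ℤ → Coef, opOf (a + b) = opOf a + opOf b := fun a b =>
    funext fun k => map_add mulOpHom (a k) (b k)
  rw [laxSeq, hadd, hadd, opOf_single, opOf_single, opOf_single, mulOp_one, lax, lam]
  abel

/-- Replacement of `T` by `T⁻¹`. -/
def reflect (a : ℤ → Coef) : ℤ → Coef := fun k => a (-k)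

theorem reflect_reflect (a : ℤ → Coef) : reflect (reflect a) = a :=
  funext fun k => congrArg a (neg_neg k)

/-- Series in Λ⁻¹ become series in T with T = Λ⁻¹, so a single theory of series bounded below, with
t = ±1, serves both P and Q. -/
theorem reflect_conv (a b : ℤ → Coef) :
    reflect (conv t a b) = conv (-t) (reflect a) (reflect b) := by
  funext n
  refine (finsum_comp_equiv (Equiv.neg ℤ)).symm.trans (finsum_congr fun i => ?_)
  simp only [Equiv.neg_apply, reflect]
  have e1 : -n - -i = -(n - i) := by ring
  have e2 : t * ((-i : ℤ) : ℝ) = -t * i := by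
    push_cast
    ring
  rw [e1, e2]

theorem reflect_single (m : ℤ) (x : Coef) : reflect (Pi.single m x) = Pi.single (-m) x := by
  funext k
  rcases eq_or_ne k (-m) with rfl | h
  · simp [reflect]
  · rw [Pi.single_eq_of_ne h, reflect, Pi.single_eq_of_ne (by omega)]

theorem reflect_laxSeq (x y z : Coef) : reflect (laxSeq x y z) = laxSeq z y x := by
  have hadd : ∀ a b : ℤ → Coef, reflect (a + b) = reflect a + reflect b := fun _ _ => rfl
  rw [laxSeq, hadd, hadd, reflect_single, reflect_single, reflect_single, laxSeq, neg_neg, neg_zero]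
  abel

end

/-! ### Existence of dressing operators -/

/-- Coefficients of a dressing operator: `U` is a right inverse of `Λ⁻ᵗ - 1`. -/
def dressingCoeff (t : ℝ) (U : Laurent → Laurent) (V W : Laurent) : ℕ → Laurent
  | 0 => 1
  | 1 => U (-V)
  | k + 2 => U (-(V * dressingCoeff t U V W (k + 1)
      + W * shiftLaurent t (dressingCoeff t U V W k)))

theorem ofLaurent_add (f g : Laurent) : ofLaurent (f + g) = ofLaurent f + ofLaurent g :=
  AddMonoidAlgebra.single_add _ _ _

theorem ofLaurent_mul (f g : Laurent) : ofLaurent (f * g) = ofLaurent f * ofLaurent g := by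
  simp only [ofLaurent]
  rw [mono_mul_mono, add_zero]

/-- The equation `(T⁻¹ + v + w T) P = P T⁻¹` has a solution with constant term `1`. -/
theorem exists_laxSeq_conv_eq {t : ℝ} (ht : t = 1 ∨ t = -1) (v w : PowerSeries Smooth) :
    ∃ p, VanishBelow p 0 ∧ p 0 = 1 ∧
      conv t (laxSeq 1 (ofSeries v) (ofSeries w)) p = conv t p (Pi.single (-1) 1) := by
  have hU : ∀ g : Laurent, ∃ f, shiftLaurent (-t) f - f = g := by
    rcases ht with rfl | rfl
    · exact exists_shiftLaurent_neg_one_sub_eq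
    · rw [neg_neg]
      exact exists_shiftLaurent_one_sub_eq
  choose U hU using hU
  have hU' : ∀ g, shiftLaurent (-t) (U g) = U g + g := fun g => by
    rw [← sub_eq_iff_eq_add', hU]
  set π := dressingCoeff t U (toLaurent v) (toLaurent w) with hπ
  set p := extendZero fun k => ofLaurent (π k) with hp
  have hp0 : VanishBelow p 0 := vanishBelow_extendZero _
  have hpn : ∀ n : ℕ, p n = ofLaurent (π n) := extendZero_natCast _
  have h0 : p 0 = 1 := hpn 0
  refine ⟨p, hp0, h0, funext fun n => ?_⟩
  rw [laxSeq_conv hp0, conv_single_right, shift_one, mul_one, one_mul, sub_neg_eq_add]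
  rcases lt_or_ge n (-1) with h | h
  · rw [hp0 _ (by omega), hp0 _ (by omega), hp0 _ (by omega)]
    simp
  -- The equation in degree k - 1 is the one that determines the k-th coefficient, as T⁻¹ lowers the
  -- degree by one.
  · obtain ⟨k, rfl⟩ : ∃ k : ℕ, n = k - 1 := ⟨(n + 1).toNat, by omega⟩
    rw [sub_add_cancel]
    rcases k with _ | _ | k
    · rw [Nat.cast_zero, hp0 (0 - 1) (by omega), hp0 (0 - 1 - 1) (by omega), h0, shift_one]
      simp
    · have e1 : ((0 + 1 : ℕ) : ℤ) - 1 = 0 := by norm_num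
      rw [e1, hp0 (0 - 1) (by simp), h0, hpn, shift_ofLaurent]
      have e2 : π (0 + 1) = U (-toLaurent v) := rfl
      rw [e2, hU', ofLaurent_add, map_zero, mul_zero, add_zero, mul_one, add_assoc, ofSeries,
        ← ofLaurent_add, neg_add_cancel]
      simp [ofLaurent]
    · have e1 : ((k + 1 + 1 : ℕ) : ℤ) - 1 = (k + 1 : ℕ) := by push_cast; ring
      have e2 : ((k + 1 : ℕ) : ℤ) - 1 = k := by push_cast; ring
      rw [e1, e2, hpn, hpn, hpn, shift_ofLaurent, shift_ofLaurent]
      have e3 : π (k + 1 + 1) = U (-(toLaurent v * π (k + 1)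
        + toLaurent w * shiftLaurent t (π k))) := rfl
      rw [e3, hU', ofSeries, ofSeries, ← ofLaurent_mul, ← ofLaurent_mul, ← ofLaurent_add,
        ← ofLaurent_add]
      congr 1
      ring

theorem exists_dressing_seq {t : ℝ} (ht : t = 1 ∨ t = -1) (v w : PowerSeries Smooth) :
    ∃ p s, VanishBelow p 0 ∧ p 0 = 1 ∧ VanishBelow s 0 ∧ conv t p s = Pi.single 0 1 ∧
      conv t s p = Pi.single 0 1 ∧
      conv t (conv t p (Pi.single (-1) 1)) s = laxSeq 1 (ofSeries v) (ofSeries w) := by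
  obtain ⟨p, hp, hp0, h⟩ := exists_laxSeq_conv_eq ht v w
  obtain ⟨s, hs, hps, hsp⟩ := exists_inverse (t := t) hp (x := 1) (by rw [hp0, one_mul])
  refine ⟨p, s, hp, hp0, hs, hps, hsp, ?_⟩
  rw [← h, conv_assoc (vanishBelow_laxSeq _ _ _) hp hs, hps, conv_one]

/-- There is a unit `q` of `Coef` with `Λ q = e^{Λ u} q`, of the form `q = e^{ℓ/ε}`. -/
theorem exists_exponential_solution (u : PowerSeries Smooth) :
    ∃ (q q' : Coef) (ℓ : PowerSeries Smooth), q * q' = 1 ∧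
      shift 1 q = ofSeries (shiftSeries 1 (expSeries u)) * q ∧
      epsDxCoef q = ofSeries (dxSeries ℓ) * q ∧
      shiftSeries 1 ℓ - ℓ = X * shiftSeries 1 u := by
  obtain ⟨ℓ, hℓ⟩ := exists_shiftSeries_sub_eq (shiftSeries 1 u)
  set S := coeff 0 ℓ with hS
  obtain ⟨h, hh⟩ : ∃ h, ℓ - C S = X * h := X_dvd_iff.2 (by simp [hS])
  have hℓ' : ℓ = C S + X * h := by rw [← hh]; ring
  -- e^{ℓ/ε} is meaningful only after splitting ℓ = S + εh: it is the basis exponential e^{S/ε}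
  -- times the power series e^h.
  refine ⟨mono S (toLaurent (expSeries h)), mono (-S) (toLaurent (expSeries (-h))), ℓ,
    ?_, ?_, ?_, hℓ⟩
  · rw [mono_mul_mono, ← toLaurent_mul, expSeries_mul_neg, add_neg_cancel, toLaurent_one]
    rfl
  · have key : shiftQuot 1 S + shiftSeries 1 h = shiftSeries 1 u + h := by
      apply X_mul_injective
      rw [mul_add, mul_add, X_mul_shiftQuot, ← shiftSeries_X_mul, ← hℓ, ← hh, shiftSeries_sub]
      ring
    rw [shift_mono, ofSeries, ofLaurent, mono_mul_mono, zero_add, shiftLaurent_toLaurent,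
      shiftSeries_expSeries, shiftSeries_expSeries, ← toLaurent_mul, ← expSeries_add, key,
      expSeries_add, toLaurent_mul]
  · rw [epsDxCoef_apply, dxCoef_mono, ofSeries, ofLaurent, ofLaurent, mono_mul_mono, mono_mul_mono,
      zero_add, dxLaurent_toLaurent, dxSeries_expSeries, toLaurent_mul, ← add_mul, ← mul_assoc]
    congr 2
    rw [mul_add, ← mul_assoc, eps_mul_epsInv, one_mul, ← toLaurent_X, ← toLaurent_mul,
      ← toLaurent_add]
    congr 1
    rw [hℓ', dxSeries_add, dxSeries_C, dxSeries_X_mul, add_comm]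

theorem shift_neg_one_of_shift_one {q : Coef} {u : PowerSeries Smooth}
    (h : shift 1 q = ofSeries (shiftSeries 1 (expSeries u)) * q) :
    ofSeries (expSeries u) * shift (-1) q = q := by
  have := congrArg (shift (-1)) h
  rw [shift_mul, shift_shift, shift_ofSeries, shiftSeries_shiftSeries, neg_add_cancel,
    shiftSeries_zero, shift_zero] at this
  exact this.symm

theorem shift_mul_shift_eq_one {q q' : Coef} (h : q * q' = 1) (t : ℝ) :
    shift t q * shift t q' = 1 := by rw [← shift_mul, h, shift_one]

/-- P comes from the normalized problem for T = Λ⁻¹ with w = e^u. Q is q times the solution for T =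
Λ with w = Λe^u: conjugation by q turns T⁻¹ + v + wT into L. -/
theorem exists_dressing (v u : PowerSeries Smooth) : Nonempty (Dressing v u) := by
  obtain ⟨p, s, hp, hp0, hs, hps, hsp, hL⟩ :=
    exists_dressing_seq (t := -1) (Or.inr rfl) v (expSeries u)
  obtain ⟨p', s', hp', hp0', hs', hps', hsp', hL'⟩ :=
    exists_dressing_seq (t := 1) (Or.inl rfl) v (shiftSeries 1 (expSeries u))
  obtain ⟨q, q', -, hqq, hq, -, -⟩ := exists_exponential_solution u
  set b : ℤ → Coef := Pi.single 0 q with hb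
  set b' : ℤ → Coef := Pi.single 0 q' with hb'
  have vb : VanishBelow b 0 := vanishBelow_single _ _
  have vb' : VanishBelow b' 0 := vanishBelow_single _ _
  have hbb : conv 1 b b' = Pi.single 0 1 := by
    funext n
    rw [hb, conv_single_left, Int.cast_zero, mul_zero, shift_zero, sub_zero, hb']
    rcases eq_or_ne n 0 with rfl | h
    · simp [hqq]
    · rw [Pi.single_eq_of_ne h, Pi.single_eq_of_ne h, mul_zero]
  have hbb' : conv 1 b' b = Pi.single 0 1 := by
    funext n
    rw [hb', conv_single_left, Int.cast_zero, mul_zero, shift_zero, sub_zero, hb]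
    rcases eq_or_ne n 0 with rfl | h
    · simp [mul_comm q', hqq]
    · rw [Pi.single_eq_of_ne h, Pi.single_eq_of_ne h, mul_zero]
  have hQ := vb.conv hp' (t := 1)
  have hQinv := hs'.conv vb' (t := 1)
  have hΛ : VanishBelow (Pi.single (-1) 1) (-1) := vanishBelow_single _ _
  have hconj : conv 1 (conv 1 (conv 1 b p') (Pi.single (-1) 1)) (conv 1 s' b')
      = laxSeq (ofSeries (expSeries u)) (ofSeries v) 1 := by
    rw [conv_assoc vb hp' hΛ, conv_assoc vb (hp'.conv hΛ) hQinv,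
      ← conv_assoc (hp'.conv hΛ) hs' vb', hL']
    have h1 := shift_mul_shift_eq_one hqq (-1)
    have h2 := shift_mul_shift_eq_one hqq 1
    have h3 := shift_neg_one_of_shift_one hq
    -- `e1` and `e2` are the effect of conjugation by q on the extreme coefficients of the
    -- normalized operator: 1 becomes e^u at Λ⁻¹, and Λe^u becomes 1 at Λ.
    have e1 : q * shift (-1) q' = ofSeries (expSeries u) := by
      conv_lhs => rw [← h3]
      rw [mul_assoc, h1, mul_one]
    have e2 : q * (ofSeries (shiftSeries 1 (expSeries u)) * shift 1 q') = 1 := by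
      rw [← mul_assoc, mul_comm q, ← hq, h2]
    funext n
    rw [hb, conv_single_left, hb', Int.cast_zero, mul_zero, shift_zero, sub_zero,
      laxSeq_conv vb', one_mul, hb']
    simp only [laxSeq, Pi.add_apply]
    rcases eq_or_ne n (-1) with rfl | hn1
    · rw [show (-1 : ℤ) + 1 = 0 by norm_num]
      simp [e1]
    rcases eq_or_ne n 0 with rfl | hn0
    · simp only [zero_add, zero_sub, Pi.single_eq_same,
        Pi.single_eq_of_ne (show (1 : ℤ) ≠ 0 by norm_num),
        Pi.single_eq_of_ne (show (-1 : ℤ) ≠ 0 by norm_num),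
        Pi.single_eq_of_ne (show (0 : ℤ) ≠ -1 by norm_num),
        Pi.single_eq_of_ne (show (0 : ℤ) ≠ 1 by norm_num), map_zero, mul_zero, add_zero]
      rw [mul_left_comm, hqq, mul_one]
    rcases eq_or_ne n 1 with rfl | hn
    · simp only [sub_self, Pi.single_eq_same,
        Pi.single_eq_of_ne (show (1 : ℤ) + 1 ≠ 0 by norm_num),
        Pi.single_eq_of_ne (show (1 : ℤ) ≠ -1 by norm_num),
        Pi.single_eq_of_ne (show (1 : ℤ) ≠ 0 by norm_num), map_zero, mul_zero, zero_add]
      exact e2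
    · rw [Pi.single_eq_of_ne (show n + 1 ≠ 0 by omega), Pi.single_eq_of_ne hn0,
        Pi.single_eq_of_ne (show n - 1 ≠ 0 by omega), Pi.single_eq_of_ne hn1,
        Pi.single_eq_of_ne hn0, Pi.single_eq_of_ne hn]
      simp
  refine ⟨{ P := reflect p, Pinv := reflect s, Q := conv 1 b p', Qinv := conv 1 s' b',
            P_pos := fun k hk => hp _ (by omega), P_zero := hp0, Pinv_bdd := ⟨0, ?_⟩,
            P_mul_inv := ?_, P_inv_mul := ?_, Q_neg := hQ,
            Qinv_bdd := ⟨0, ?_⟩, Q_mul_inv := ?_, Q_inv_mul := ?_,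
            lax_eq_P := ?_, lax_eq_Q := ?_ }⟩
  · intro k hk
    by_contra h
    exact hk (hs _ (by omega))
  · rw [opMul_opOf, ← neg_neg (1 : ℝ), ← reflect_conv, hps, reflect_single, neg_zero,
      ← lam_eq_opOf]
  · rw [opMul_opOf, ← neg_neg (1 : ℝ), ← reflect_conv, hsp, reflect_single, neg_zero,
      ← lam_eq_opOf]
  · intro k hk
    by_contra h
    exact hk (hQinv _ (by omega))
  · rw [opMul_opOf, conv_assoc vb hp' hQinv, ← conv_assoc hp' hs' vb', hps', one_conv, hbb,
      lam_eq_opOf]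
  · rw [opMul_opOf, conv_assoc hs' vb' hQ, ← conv_assoc vb' vb hp', hbb', one_conv, hsp',
      lam_eq_opOf]
  · rw [lam_eq_opOf, opMul_opOf, opMul_opOf, lax_eq_opOf, ← reflect_laxSeq, ← hL, reflect_conv,
      reflect_conv, reflect_single, neg_neg, neg_neg]
  · rw [lam_eq_opOf, opMul_opOf, opMul_opOf, lax_eq_opOf, hconj]

/-! ### Evaluation of differential polynomials -/

/-- The values of the jet variables. -/
def jetValue (v u : PowerSeries Smooth) : JetVar → PowerSeries Smooth
  | JetVar.v m => dxSeries^[m] v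
  | JetVar.u m => dxSeries^[m] u

theorem evalPoly_eq_sum (v u : PowerSeries Smooth) (F : DiffPoly) : evalPoly v u F
    = F.coeff.sum fun k p => MvPolynomial.aeval (jetValue v u) p * expSeries (k • u) := by
  have : (fun | JetVar.v m => dxSeries^[m] v | JetVar.u m => dxSeries^[m] u) = jetValue v u := by
    funext j
    cases j <;> rfl
  rw [← this]
  rfl

theorem evalPoly_add (v u : PowerSeries Smooth) (F G : DiffPoly) :
    evalPoly v u (F + G) = evalPoly v u F + evalPoly v u G := by
  simp only [evalPoly_eq_sum]
  exact Finsupp.sum_add_index' (fun k => by simp) (fun k p q => by rw [map_add, add_mul])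

theorem evalPoly_zero (v u : PowerSeries Smooth) : evalPoly v u 0 = 0 := by
  rw [evalPoly_eq_sum]
  exact Finsupp.sum_zero_index

theorem evalPoly_single (v u : PowerSeries Smooth) (k : ℤ) (p : MvPolynomial JetVar ℝ) :
    evalPoly v u (AddMonoidAlgebra.single k p)
      = MvPolynomial.aeval (jetValue v u) p * expSeries (k • u) := by
  rw [evalPoly_eq_sum]
  exact Finsupp.sum_single_index (by simp)

theorem evalPoly_mul (v u : PowerSeries Smooth) (F G : DiffPoly) :
    evalPoly v u (F * G) = evalPoly v u F * evalPoly v u G := by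
  induction F using AddMonoidAlgebra.induction_linear with
  | zero => simp [evalPoly_zero]
  | add F F' h h' => rw [add_mul, evalPoly_add, h, h', evalPoly_add, add_mul]
  | single k p =>
    induction G using AddMonoidAlgebra.induction_linear with
    | zero => simp [evalPoly_zero]
    | add G G' h h' => rw [mul_add, evalPoly_add, h, h', evalPoly_add, mul_add]
    | single l q =>
      rw [AddMonoidAlgebra.single_mul_single, evalPoly_single, evalPoly_single, evalPoly_single,
        map_mul, add_smul, expSeries_add]
      ring

theorem evalPoly_one (v u : PowerSeries Smooth) : evalPoly v u 1 = 1 := by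
  rw [AddMonoidAlgebra.one_def, evalPoly_single, map_one, zero_smul, expSeries_zero, one_mul]

/-- Evaluation of differential polynomials as a ring homomorphism. -/
def evalPolyHom (v u : PowerSeries Smooth) : DiffPoly →+* PowerSeries Smooth where
  toFun := evalPoly v u
  map_zero' := evalPoly_zero v u
  map_one' := evalPoly_one v u
  map_add' := evalPoly_add v u
  map_mul' := evalPoly_mul v u

/-- Real constants as differential polynomials. -/
def const : ℝ →+* DiffPoly := AddMonoidAlgebra.singleZeroRingHom.comp MvPolynomial.C

theorem evalPoly_const_mul (v u : PowerSeries Smooth) (c : ℝ) (F : DiffPoly) :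
    evalPoly v u (const c * F) = c • evalPoly v u F := by
  have : evalPoly v u (const c) = c • 1 := by
    change evalPoly v u (AddMonoidAlgebra.single 0 (MvPolynomial.C c)) = _
    rw [evalPoly_single, zero_smul, expSeries_zero, mul_one, MvPolynomial.aeval_C,
      Algebra.algebraMap_eq_smul_one]
  rw [evalPoly_mul, this, smul_mul_assoc, one_mul]

/-- The jet variables as differential polynomials. -/
def jet (j : JetVar) : DiffPoly := AddMonoidAlgebra.single 0 (MvPolynomial.X j)

theorem evalPoly_jet (v u : PowerSeries Smooth) (j : JetVar) :
    evalPoly v u (jet j) = jetValue v u j := by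
  rw [jet, evalPoly_single, zero_smul, expSeries_zero, mul_one, MvPolynomial.aeval_X]

/-- `e^{ku}` as a differential polynomial. -/
def expJet (k : ℤ) : DiffPoly := AddMonoidAlgebra.single k 1

theorem evalPoly_expJet (v u : PowerSeries Smooth) (k : ℤ) :
    evalPoly v u (expJet k) = expSeries (k • u) := by
  rw [expJet, evalPoly_single, map_one, one_mul]

theorem dxSeries_zsmul (k : ℤ) (f : PowerSeries Smooth) : dxSeries (k • f) = k • dxSeries f := by
  rw [← Int.cast_smul_eq_zsmul ℝ, ← Int.cast_smul_eq_zsmul ℝ, dxSeries_smul]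

theorem exists_dxSeries_evalPoly_mul {F G : DiffPoly}
    (hF : ∃ F', ∀ v u, dxSeries (evalPoly v u F) = evalPoly v u F')
    (hG : ∃ G', ∀ v u, dxSeries (evalPoly v u G) = evalPoly v u G') :
    ∃ H, ∀ v u, dxSeries (evalPoly v u (F * G)) = evalPoly v u H := by
  obtain ⟨F', hF⟩ := hF
  obtain ⟨G', hG⟩ := hG
  exact ⟨F' * G + F * G', fun v u => by
    rw [evalPoly_mul, dxSeries_mul, hF, hG, evalPoly_add, evalPoly_mul, evalPoly_mul]⟩

/-- The values of differential polynomials are closed under `∂ₓ`. -/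
theorem exists_dxSeries_evalPoly (F : DiffPoly) :
    ∃ F', ∀ v u, dxSeries (evalPoly v u F) = evalPoly v u F' := by
  induction F using AddMonoidAlgebra.induction_linear with
  | zero => exact ⟨0, fun v u => by simp [evalPoly_zero, dxSeries]; rfl⟩
  | add F G hF hG =>
    obtain ⟨F', hF⟩ := hF
    obtain ⟨G', hG⟩ := hG
    exact ⟨F' + G', fun v u => by rw [evalPoly_add, dxSeries_add, hF, hG, evalPoly_add]⟩
  | single k p =>
    have e : (AddMonoidAlgebra.single k p : DiffPoly) = AddMonoidAlgebra.single 0 p * expJet k := by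
      rw [expJet, AddMonoidAlgebra.single_mul_single, zero_add, mul_one]
    rw [e]
    refine exists_dxSeries_evalPoly_mul ?_ ⟨const k * (jet (.u 1) * expJet k), fun v u => ?_⟩
    · clear e
      induction p using MvPolynomial.induction_on with
      | C c =>
        refine ⟨0, fun v u => ?_⟩
        have : AddMonoidAlgebra.single 0 (MvPolynomial.C c) = const c * 1 := (mul_one _).symm
        rw [this, evalPoly_const_mul, evalPoly_zero, evalPoly_one, dxSeries_smul,
          ← map_one (C (R := Smooth)), dxSeries_C, dx_one, map_zero, smul_zero]
      | add p q hp hq =>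
        obtain ⟨p', hp⟩ := hp
        obtain ⟨q', hq⟩ := hq
        exact ⟨p' + q', fun v u => by
          rw [AddMonoidAlgebra.single_add, evalPoly_add, dxSeries_add, hp, hq, evalPoly_add]⟩
      | mul_X p j hp =>
        have e : (AddMonoidAlgebra.single 0 (p * MvPolynomial.X j) : DiffPoly)
            = AddMonoidAlgebra.single 0 p * jet j := by
          rw [jet, AddMonoidAlgebra.single_mul_single, zero_add]
        rw [e]
        refine exists_dxSeries_evalPoly_mul hp ?_
        rcases j with m | m
        · exact ⟨jet (.v (m + 1)), fun v u => by
            rw [evalPoly_jet, evalPoly_jet, jetValue, jetValue, Function.iterate_succ_apply']⟩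
        · exact ⟨jet (.u (m + 1)), fun v u => by
            rw [evalPoly_jet, evalPoly_jet, jetValue, jetValue, Function.iterate_succ_apply']⟩
    · rw [evalPoly_const_mul, evalPoly_mul, evalPoly_jet, evalPoly_expJet, dxSeries_expSeries,
        dxSeries_zsmul, Int.cast_smul_eq_zsmul, smul_mul_assoc]
      rfl

theorem exists_iterate_dxSeries_evalPoly (F : DiffPoly) :
    ∃ f : ℕ → DiffPoly, ∀ j v u, dxSeries^[j] (evalPoly v u F) = evalPoly v u (f j) := by
  choose D hD using exists_dxSeries_evalPoly
  refine ⟨fun j => D^[j] F, fun j v u => ?_⟩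
  induction j with
  | zero => rfl
  | succ j ih =>
    dsimp only at ih ⊢
    rw [Function.iterate_succ_apply', ih, hD, Function.iterate_succ_apply']

/-! ### Evaluation on the ring `𝓡` -/

theorem coeff_evalRing (v u : PowerSeries Smooth) (g : DiffRing) (n : ℕ) :
    coeff n (evalRing v u g) = ∑ p ∈ antidiagonal n,
      coeff p.2 (evalPoly v u (coeff p.1 g)) := coeff_mk _ _

theorem evalRing_add (v u : PowerSeries Smooth) (f g : DiffRing) :
    evalRing v u (f + g) = evalRing v u f + evalRing v u g := by
  ext1 n
  simp only [coeff_evalRing, map_add, evalPoly_add, sum_add_distrib]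

theorem evalRing_C (v u : PowerSeries Smooth) (F : DiffPoly) :
    evalRing v u (C F) = evalPoly v u F := by
  ext1 n
  rw [coeff_evalRing, sum_eq_single (0, n)]
  · simp
  · intro p hp hne
    have : p.1 ≠ 0 := fun h => hne (Prod.ext h (by simpa [h] using mem_antidiagonal.1 hp))
    rw [coeff_C, if_neg this, evalPoly_zero, map_zero]
  · simp

theorem evalRing_zero (v u : PowerSeries Smooth) : evalRing v u 0 = 0 := by
  rw [← map_zero (C (R := DiffPoly)), evalRing_C, evalPoly_zero]

theorem evalRing_one (v u : PowerSeries Smooth) : evalRing v u 1 = 1 := by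
  rw [← map_one (C (R := DiffPoly)), evalRing_C, evalPoly_one]

theorem evalRing_X_mul (v u : PowerSeries Smooth) (g : DiffRing) :
    evalRing v u (X * g) = X * evalRing v u g := by
  ext1 n
  rw [coeff_evalRing]
  cases n with
  | zero => simp [evalPoly_zero]
  | succ n =>
    rw [Nat.sum_antidiagonal_succ, coeff_succ_X_mul, coeff_evalRing]
    simp only [coeff_succ_X_mul]
    simp [evalPoly_zero]

/-- Induction on the order in ε: writing f = a + εf' and g = b + εg' gives fg = ab + ε(f'g + ag'),
and evaluation is already multiplicative on constant terms. -/
theorem evalRing_mul (v u : PowerSeries Smooth) (f g : DiffRing) :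
    evalRing v u (f * g) = evalRing v u f * evalRing v u g := by
  have hdec : ∀ f : DiffRing, ∃ f', f = C (coeff 0 f) + X * f' := fun f => by
    obtain ⟨f', hf⟩ : ∃ h, f - C (coeff 0 f) = X * h := X_dvd_iff.2 (by simp)
    exact ⟨f', by rw [← hf]; ring⟩
  ext1 n
  induction n generalizing f g with
  | zero => simp only [coeff_zero_mul', coeff_evalRing]; simp [evalPoly_mul]
  | succ n ih =>
    obtain ⟨f', hf⟩ := hdec f
    obtain ⟨g', hg⟩ := hdec g
    set a := coeff 0 f
    set b := coeff 0 g
    have e1 : f * g = C (a * b) + X * (f' * g + C a * g') := by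
      rw [map_mul]
      conv_lhs => rw [hf, hg]
      conv_rhs => rw [hg]
      ring
    have e2 : evalRing v u f * evalRing v u g = evalPoly v u (a * b)
        + X * (evalRing v u f' * evalRing v u g + evalRing v u (C a) * evalRing v u g') := by
      conv_lhs => rw [hf, hg]
      conv_rhs => rw [hg]
      simp only [evalRing_add, evalRing_X_mul, evalRing_C, evalPoly_mul]
      ring
    rw [e1, e2, evalRing_add, evalRing_C, evalRing_X_mul, map_add, map_add, coeff_succ_X_mul,
      coeff_succ_X_mul, evalRing_add, map_add, map_add, ih, ih]

/-- Evaluation on `𝓡` as a ring homomorphism. -/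
def evalRingHom (v u : PowerSeries Smooth) : DiffRing →+* PowerSeries Smooth where
  toFun := evalRing v u
  map_zero' := evalRing_zero v u
  map_one' := evalRing_one v u
  map_add' := evalRing_add v u
  map_mul' := evalRing_mul v u

/-! ### Polynomial dependence on an integer -/

/-- Power series in `ε` whose coefficients are differential polynomials depending polynomially on
an integer `m`. -/
abbrev PolyDiffRing : Type := PowerSeries (Polynomial DiffPoly)

/-- Specialization of the integer. -/
def specialize (m : ℕ) : PolyDiffRing →+* DiffRing :=
  PowerSeries.map (Polynomial.evalRingHom (m : DiffPoly))

theorem coeff_specialize (m : ℕ) (g : PolyDiffRing) (n : ℕ) :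
    coeff n (specialize m g) = (coeff n g).eval (m : DiffPoly) := by
  rw [specialize, coeff_map]
  rfl

/-- The coefficient of the first power of the integer. -/
def linearPart (g : PolyDiffRing) : DiffRing := PowerSeries.mk fun n => (coeff n g).coeff 1

/-- The shift by `τ (m + c)` of a differential polynomial depends polynomially on `m`. -/
theorem exists_specialize_eq_shiftSeries (F : DiffPoly) (τ c : ℝ) :
    ∃ V : PolyDiffRing, ∀ v u (m : ℕ),
      evalRing v u (specialize m V) = shiftSeries (τ * (m + c)) (evalPoly v u F) := by
  obtain ⟨f, hf⟩ := exists_iterate_dxSeries_evalPoly F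
  refine ⟨PowerSeries.mk fun j => Polynomial.C (const (τ ^ j / (j.factorial : ℝ))) *
    (Polynomial.X + Polynomial.C (const c)) ^ j * Polynomial.C (f j), fun v u m => ?_⟩
  ext1 n
  rw [coeff_evalRing, coeff_shiftSeries]
  refine sum_congr rfl fun p _ => ?_
  have e : (coeff p.1) (specialize m (PowerSeries.mk fun j =>
      Polynomial.C (const (τ ^ j / (j.factorial : ℝ))) *
      (Polynomial.X + Polynomial.C (const c)) ^ j * Polynomial.C (f j)))
      = const ((τ * (m + c)) ^ p.1 / (p.1.factorial : ℝ)) * f p.1 := by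
    rw [coeff_specialize, coeff_mk]
    simp only [Polynomial.eval_mul, Polynomial.eval_C, Polynomial.eval_pow, Polynomial.eval_add,
      Polynomial.eval_X]
    rw [← map_natCast const m, ← map_add, ← map_pow, ← map_mul]
    congr 2
    rw [mul_pow]
    ring
  rw [e, evalPoly_const_mul, ← hf, PowerSeries.coeff_smul]
  congr 1
  generalize evalPoly v u F = y
  induction p.1 generalizing y with
  | zero => rfl
  | succ k ih => rw [Function.iterate_succ_apply, ih, coeff_dxSeries, pow_succ,
      Module.End.mul_apply]

theorem exists_polynomial_sum_range (p : Polynomial DiffPoly) : ∃ h : Polynomial DiffPoly,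
    ∀ m : ℕ, h.eval (m : DiffPoly) = ∑ i ∈ range m, p.eval (i : DiffPoly) := by
  induction p using Polynomial.induction_on' with
  | add p q hp hq =>
    obtain ⟨h, hp⟩ := hp
    obtain ⟨k, hq⟩ := hq
    exact ⟨h + k, fun m => by simp only [Polynomial.eval_add, hp, hq, sum_add_distrib]⟩
  | monomial l a =>
    set φ : ℚ →+* DiffPoly := const.comp (Rat.castHom ℝ) with hφ
    -- Faulhaber's polynomial for ∑ kˡ over k < m.
    set h : Polynomial ℚ := ∑ i ∈ range (l + 1),
      Polynomial.C (bernoulli i * ((l + 1).choose i) / (l + 1)) * Polynomial.X ^ (l + 1 - i)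
    have hh : ∀ m : ℕ, h.eval (m : ℚ) = ∑ k ∈ range m, (k : ℚ) ^ l := by
      intro m
      rw [sum_range_pow, Polynomial.eval_finsetSum]
      refine sum_congr rfl fun i _ => ?_
      simp only [Polynomial.eval_mul, Polynomial.eval_C, Polynomial.eval_pow, Polynomial.eval_X]
      ring
    refine ⟨Polynomial.C a * h.map φ, fun m => ?_⟩
    rw [Polynomial.eval_mul, Polynomial.eval_C, Polynomial.eval_natCast_map, hh, map_sum, mul_sum]
    simp [Polynomial.eval_monomial]

theorem exists_specialize_eq_sum_range (G : PolyDiffRing) :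
    ∃ H : PolyDiffRing, ∀ m, specialize m H = ∑ i ∈ range m, specialize i G := by
  choose h hh using fun n => exists_polynomial_sum_range (coeff n G)
  refine ⟨PowerSeries.mk h, fun m => ?_⟩
  ext1 n
  rw [coeff_specialize, coeff_mk, hh, map_sum]
  simp only [coeff_specialize]

/-- The coefficients of `F m`, at each point, are polynomials in `m` whose linear coefficients are
given by `F'`. -/
def HasLinearPart (F : ℕ → PowerSeries Smooth) (F' : PowerSeries Smooth) : Prop :=
  ∀ n x, ∃ q : Polynomial ℝ, (∀ m : ℕ, evalAt x (coeff n (F m)) = q.eval (m : ℝ)) ∧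
    evalAt x (coeff n F') = q.coeff 1

/-- Real polynomials with equal values at all natural numbers coincide. This is where information
about integer powers of L passes to the derivative at m = 0. -/
theorem HasLinearPart.unique {F : ℕ → PowerSeries Smooth} {F' F'' : PowerSeries Smooth}
    (h' : HasLinearPart F F') (h'' : HasLinearPart F F'') : F' = F'' := by
  ext1 n
  refine Smooth.ext fun x => ?_
  obtain ⟨q, hq, hq'⟩ := h' n x
  obtain ⟨r, hr, hr'⟩ := h'' n x
  have : q = r := by
    refine Polynomial.eq_of_infinite_eval_eq q r ?_
    refine (Set.infinite_range_of_injective (Nat.cast_injective (R := ℝ))).mono ?_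
    rintro _ ⟨m, rfl⟩
    exact (hq m).symm.trans (hr m)
  rw [← evalAt_apply, ← evalAt_apply, hq', hr', this]

theorem HasLinearPart.sum {ι : Type*} {s : Finset ι} {F : ι → ℕ → PowerSeries Smooth}
    {F' : ι → PowerSeries Smooth} (h : ∀ i ∈ s, HasLinearPart (F i) (F' i)) :
    HasLinearPart (fun m => ∑ i ∈ s, F i m) (∑ i ∈ s, F' i) := by
  intro n x
  choose! q hq hq' using fun i hi => h i hi n x
  refine ⟨∑ i ∈ s, q i, fun m => ?_, ?_⟩
  · rw [map_sum, map_sum, Polynomial.eval_finsetSum]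
    exact sum_congr rfl fun i hi => hq i hi m
  · rw [map_sum, map_sum, Polynomial.finsetSum_coeff]
    exact sum_congr rfl hq'

theorem HasLinearPart.const_mul {F : ℕ → PowerSeries Smooth} {F' : PowerSeries Smooth}
    (h : HasLinearPart F F') (y : PowerSeries Smooth) :
    HasLinearPart (fun m => y * F m) (y * F') := by
  intro n x
  choose q hq hq' using fun n => h n x
  refine ⟨∑ p ∈ antidiagonal n, Polynomial.C (evalAt x (coeff p.1 y)) * q p.2, fun m => ?_, ?_⟩
  · rw [coeff_mul, map_sum, Polynomial.eval_finsetSum]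
    exact sum_congr rfl fun p _ => by rw [map_mul, hq, Polynomial.eval_mul, Polynomial.eval_C]
  · rw [coeff_mul, map_sum, Polynomial.finsetSum_coeff]
    exact sum_congr rfl fun p _ => by rw [map_mul, hq', Polynomial.coeff_C_mul]

/-- At a fixed order of ε the expansion of e^{τmε∂ₓ} is a finite sum, polynomial in m, with linear
term τε∂ₓ. -/
theorem hasLinearPart_shiftSeries (τ : ℝ) (y : PowerSeries Smooth) :
    HasLinearPart (fun m => shiftSeries (τ * m) y) (τ • (X * dxSeries y)) := by
  intro n x
  refine ⟨∑ p ∈ antidiagonal n, Polynomial.C (τ ^ p.1 / (p.1.factorial : ℝ)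
    * evalAt x ((dx ^ p.1) (coeff p.2 y))) * Polynomial.X ^ p.1, fun m => ?_, ?_⟩
  · rw [coeff_shiftSeries, map_sum, Polynomial.eval_finsetSum]
    refine sum_congr rfl fun p _ => ?_
    rw [map_smul, smul_eq_mul, Polynomial.eval_mul, Polynomial.eval_C, Polynomial.eval_pow,
      Polynomial.eval_X, mul_pow]
    ring
  · rw [Polynomial.finsetSum_coeff]
    simp only [Polynomial.coeff_C_mul, Polynomial.coeff_X_pow]
    cases n with
    | zero => simp
    | succ n =>
      rw [sum_eq_single (1, n)]
      · rw [PowerSeries.coeff_smul, coeff_succ_X_mul]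
        simp
      · intro p hp hne
        have : 1 ≠ p.1 := fun h => hne <| Prod.ext h.symm <| by
          have := mem_antidiagonal.1 hp
          dsimp only
          omega
        rw [if_neg this, mul_zero]
      · intro h
        exact absurd (mem_antidiagonal.2 (add_comm 1 n)) h

theorem hasLinearPart_evalRing_specialize (v u : PowerSeries Smooth) (g : PolyDiffRing) :
    HasLinearPart (fun m => evalRing v u (specialize m g)) (evalRing v u (linearPart g)) := by
  have key : ∀ (P : Polynomial DiffPoly) (b : ℕ) (x : ℝ), ∃ q : Polynomial ℝ,
      (∀ m : ℕ, evalAt x (coeff b (evalPoly v u (P.eval (m : DiffPoly)))) = q.eval (m : ℝ)) ∧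
      evalAt x (coeff b (evalPoly v u (P.coeff 1))) = q.coeff 1 := by
    intro P b x
    induction P using Polynomial.induction_on' with
    | add P Q hP hQ =>
      obtain ⟨p, hp, hp'⟩ := hP
      obtain ⟨q, hq, hq'⟩ := hQ
      refine ⟨p + q, fun m => ?_, ?_⟩
      · rw [Polynomial.eval_add, evalPoly_add, map_add, map_add, hp, hq, Polynomial.eval_add]
      · rw [Polynomial.coeff_add, evalPoly_add, map_add, map_add, hp', hq', Polynomial.coeff_add]
    | monomial l a =>
      refine ⟨Polynomial.monomial l (evalAt x (coeff b (evalPoly v u a))), fun m => ?_, ?_⟩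
      · have e : a * (m : DiffPoly) ^ l = (m ^ l) • a := by
          rw [nsmul_eq_mul, mul_comm, Nat.cast_pow]
        rw [Polynomial.eval_monomial, Polynomial.eval_monomial, e]
        change evalAt x (coeff b (evalPolyHom v u ((m ^ l) • a))) = _
        rw [map_nsmul, map_nsmul, map_nsmul, nsmul_eq_mul, mul_comm, Nat.cast_pow]
        rfl
      · rw [Polynomial.coeff_monomial, Polynomial.coeff_monomial]
        split_ifs
        · rfl
        · rw [evalPoly_zero, map_zero, map_zero]
  intro n x
  choose q hq hq' using key
  refine ⟨∑ p ∈ antidiagonal n, q (coeff p.1 g) p.2 x, fun m => ?_, ?_⟩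
  · rw [coeff_evalRing, map_sum, Polynomial.eval_finsetSum]
    refine sum_congr rfl fun p _ => ?_
    rw [coeff_specialize, hq]
  · rw [coeff_evalRing, map_sum, Polynomial.finsetSum_coeff]
    refine sum_congr rfl fun p _ => ?_
    rw [linearPart, coeff_mk, hq']

/-! ### Interpolation -/

theorem toLaurent_smul (c : ℝ) (f : PowerSeries Smooth) : toLaurent (c • f) = c • toLaurent f := by
  ext1
  funext n
  rcases lt_or_ge n 0 with h | h
  · rw [toLaurent_coeff_neg _ h, HahnSeries.coeff_smul, toLaurent_coeff_neg _ h, smul_zero]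
  · lift n to ℕ using h
    rw [toLaurent_coeff, HahnSeries.coeff_smul, toLaurent_coeff, PowerSeries.coeff_smul]

theorem toLaurent_X_pow (n : ℕ) : toLaurent (X ^ n) = epsPow n := HahnSeries.ofPowerSeries_X_pow _

theorem toLaurent_sum {ι : Type*} (s : Finset ι) (f : ι → PowerSeries Smooth) :
    toLaurent (∑ i ∈ s, f i) = ∑ i ∈ s, toLaurent (f i) :=
  map_sum (HahnSeries.ofPowerSeries ℤ Smooth) f s

theorem exists_epsPow_mul_eq_of_finset {ι : Type*} (s : Finset ι) (f : ι → Laurent) :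
    ∃ (N : ℕ) (g : ι → PowerSeries Smooth), ∀ i ∈ s, epsPow N * f i = toLaurent (g i) := by
  choose N hN using fun i => exists_epsPow_mul_eq (f i)
  choose! g hg using fun i (hi : i ∈ s) => hN i (s.sup N) (le_sup hi)
  exact ⟨s.sup N, g, hg⟩

/-- Multiplying all factors by high powers of ε, which commute with shifts and ∂ₓ, reduces to power
series, where linear parts can be compared. -/
theorem sum_linearPart_laurent {ι : Type*} {s : Finset ι} {x y : ι → Laurent} {τ : ℝ}
    {F : ℕ → PowerSeries Smooth} {F' : PowerSeries Smooth} (hF : HasLinearPart F F')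
    (h : ∀ m : ℕ, ∑ i ∈ s, x i * shiftLaurent (τ * m) (y i) = toLaurent (F m)) :
    ∑ i ∈ s, x i * (τ • (eps * dxLaurent (y i))) = toLaurent F' := by
  obtain ⟨N, x', hx⟩ := exists_epsPow_mul_eq_of_finset s x
  obtain ⟨M, y', hy⟩ := exists_epsPow_mul_eq_of_finset s y
  have h1 : ∀ m : ℕ, ∑ i ∈ s, x' i * shiftSeries (τ * m) (y' i) = X ^ N * X ^ M * F m := by
    intro m
    apply toLaurent_injective
    rw [toLaurent_sum, toLaurent_mul, toLaurent_mul, ← h, toLaurent_X_pow, toLaurent_X_pow, mul_sum]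
    refine sum_congr rfl fun i hi => ?_
    rw [toLaurent_mul, ← hx i hi, ← shiftLaurent_toLaurent, ← hy i hi, shiftLaurent_epsPow_mul]
    ring
  have h2 := HasLinearPart.sum (s := s) fun i _ =>
    (hasLinearPart_shiftSeries τ (y' i)).const_mul (x' i)
  have h3 := hF.const_mul (X ^ N * X ^ M)
  simp only [← h1] at h3
  have h4 := congrArg toLaurent (h2.unique h3)
  rw [toLaurent_sum, toLaurent_mul, toLaurent_mul, toLaurent_X_pow, toLaurent_X_pow,
    mul_assoc] at h4
  apply epsPow_mul_injective M
  apply epsPow_mul_injective N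
  rw [← h4, mul_sum, mul_sum]
  refine sum_congr rfl fun i hi => ?_
  rw [toLaurent_mul, ← hx i hi, toLaurent_smul, toLaurent_mul, ← dxLaurent_toLaurent, ← hy i hi,
    dxLaurent_epsPow_mul, toLaurent_X]
  simp only [mul_smul_comm]
  congr 1
  ring

theorem hasLinearPart_const (y : PowerSeries Smooth) : HasLinearPart (fun _ => y) 0 := fun n x =>
  ⟨Polynomial.C (evalAt x (coeff n y)), fun m => by simp, by simp⟩

/-- For a constant exponent the factor e^{(S(x+tε)-S(x))/ε} is 1, so the shift acts on coefficients
without twist and depends polynomially on t at each order of ε. -/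
theorem ConstExp.coeff_shift {c : Coef} (hc : ConstExp c) (t : ℝ) (S : Smooth) :
    (shift t c).coeff S = shiftLaurent t (c.coeff S) := by
  rw [Toda.coeff_shift]
  by_cases hS : dx S = 0
  · rw [shiftQuot_of_dx_eq_zero t hS, expSeries_zero, toLaurent_one, one_mul]
  · rw [hc S hS, map_zero, mul_zero]

theorem ConstExp.shift {c : Coef} (hc : ConstExp c) (t : ℝ) : ConstExp (shift t c) := fun S hS => by
  rw [hc.coeff_shift, hc S hS, map_zero]

theorem ConstExp.coeff_epsDxCoef {c : Coef} (hc : ConstExp c) (S : Smooth) :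
    (epsDxCoef c).coeff S = eps * dxLaurent (c.coeff S) := by
  rw [Toda.coeff_epsDxCoef]
  by_cases hS : dx S = 0
  · rw [hS, map_zero, toLaurent_zero, zero_mul, add_zero]
  · rw [hc S hS, mul_zero, add_zero]

theorem coeff_mul_eq_sum (c d : Coef) (S : Smooth) :
    (c * d).coeff S = ∑ R ∈ c.coeff.support, c.coeff R * d.coeff (S - R) := by
  rw [AddMonoidAlgebra.coeff_mul_apply_left]
  simp only [neg_add_eq_sub]
  rfl

theorem coeff_sum_mul {ι : Type*} (s : Finset ι) (c d : ι → Coef) (S : Smooth) :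
    (∑ i ∈ s, c i * d i).coeff S = ∑ q ∈ s.sigma fun i => (c i).coeff.support,
      (c q.1).coeff q.2 * (d q.1).coeff (S - q.2) := by
  rw [AddMonoidAlgebra.coeff_sum, Finsupp.finsetSum_apply, sum_sigma]
  exact sum_congr rfl fun i _ => coeff_mul_eq_sum _ _ _

/-- The comparison is made separately on each e^{S/ε}; only the factors that get shifted need
constant exponents. -/
theorem sum_linearPart_coef {ι : Type*} {s : Finset ι} {c d : ι → Coef} {τ : ℝ}
    {F : ℕ → PowerSeries Smooth} {F' : PowerSeries Smooth} (hF : HasLinearPart F F')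
    (hd : ∀ i ∈ s, ConstExp (d i))
    (h : ∀ m : ℕ, ∑ i ∈ s, c i * shift (τ * m) (d i) = ofSeries (F m)) :
    ∑ i ∈ s, c i * (τ • epsDxCoef (d i)) = ofSeries F' := by
  ext S : 2
  rw [coeff_sum_mul]
  have h' : ∀ m : ℕ, ∑ q ∈ s.sigma fun i => (c i).coeff.support,
      (c q.1).coeff q.2 * shiftLaurent (τ * m) ((d q.1).coeff (S - q.2))
      = (ofSeries (F m)).coeff S := by
    intro m
    rw [← h m, coeff_sum_mul]
    refine sum_congr rfl fun q hq => ?_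
    rw [(hd q.1 (mem_sigma.1 hq).1).coeff_shift]
  have e : ∀ q ∈ s.sigma fun i => (c i).coeff.support,
      (c q.1).coeff q.2 * (τ • epsDxCoef (d q.1)).coeff (S - q.2)
      = (c q.1).coeff q.2 * (τ • (eps * dxLaurent ((d q.1).coeff (S - q.2)))) := by
    intro q hq
    rw [← (hd q.1 (mem_sigma.1 hq).1).coeff_epsDxCoef]
    rfl
  rw [sum_congr rfl e]
  rcases eq_or_ne S 0 with rfl | hS
  · have e0 : ∀ f : PowerSeries Smooth, (ofSeries f).coeff 0 = toLaurent f := fun f =>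
      Finsupp.single_eq_same
    rw [e0]
    simp only [e0] at h'
    exact sum_linearPart_laurent hF h'
  · have e0 : ∀ f : PowerSeries Smooth, (ofSeries f).coeff S = toLaurent 0 := fun f => by
      rw [toLaurent_zero]
      exact Finsupp.single_eq_of_ne hS
    rw [e0]
    -- For S ≠ 0 the right-hand side has no component at e^{S/ε}, so the comparison is with the zero
    -- family.
    simp only [e0] at h'
    exact sum_linearPart_laurent (hasLinearPart_const 0) h'

theorem conv_eq_sum_Icc_of_le {t : ℝ} {a b : ℤ → Coef} {A B N : ℤ} (ha : VanishBelow a A)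
    (hb : VanishBelow b B) (n : ℤ) (hN : n - B ≤ N) :
    conv t a b n = ∑ i ∈ Icc A N, a i * shift (t * i) (b (n - i)) := by
  rw [conv_eq_sum_Icc ha hb]
  refine sum_subset (Icc_subset_Icc_right hN) fun i hi hi' => ?_
  rw [mem_Icc] at hi hi'
  rw [hb (n - i) (by omega), map_zero, mul_zero]

/-! ### Powers of the normalized Lax operator and the inverse dressing series -/

section

variable {t : ℝ} {p s : ℤ → Coef} {A B : ℤ} {v w : PowerSeries Smooth}
  {a : ℕ → ℕ → PowerSeries Smooth}

/-- The equation `S (T⁻¹ + v + w T) = T⁻¹ S` in terms of the coefficients of `S`. -/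
def IsInverseDressing (t : ℝ) (v w : PowerSeries Smooth) (s : ℤ → Coef) : Prop :=
  ∀ k : ℤ, shift (-t) (s k) = s k + s (k - 1) * shift (t * (k - 1)) (ofSeries v)
    + s (k - 2) * shift (t * (k - 2)) (ofSeries w)

/-- The recurrence expresses (T⁻¹ - 1)s_k through s_{k-1} and s_{k-2} times power series, so
constancy of the exponents propagates upwards from the range where s vanishes. -/
theorem IsInverseDressing.constExp (hs : IsInverseDressing t v w s) (ht : t ≠ 0)
    (hB : VanishBelow s B) (k : ℤ) : ConstExp (s k) := by
  have key : ∀ (n : ℕ) (k : ℤ), k < B + n → ConstExp (s k) := by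
    intro n
    induction n with
    | zero =>
      intro k hk
      rw [hB k (by simpa using hk)]
      exact constExp_zero
    | succ n ih =>
      intro k hk
      push_cast at hk
      refine ConstExp.of_shift_sub (neg_ne_zero.2 ht) ?_
      rw [hs k, add_assoc, add_sub_cancel_left, shift_ofSeries, shift_ofSeries]
      exact ((ih _ (by omega)).mul_ofSeries _).add ((ih _ (by omega)).mul_ofSeries _)
  exact key (k - B + 1).toNat k (by omega)

/-- The coefficients of `(T⁻¹ + v + w T)ᵐ Tᵐ` at powers of `T`. -/
structure IsPowerCoeff (t : ℝ) (v w : PowerSeries Smooth) (a : ℕ → ℕ → PowerSeries Smooth) :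
    Prop where
  zero : ∀ m, a 0 m = 1
  one : ∀ m, a 1 m = ∑ i ∈ range m, shiftSeries (t * (0 - i)) v
  add_two : ∀ n m, a (n + 2) m = ∑ i ∈ range m, (a (n + 1) i * shiftSeries (t * (n + 1 - i)) v
    + a n i * shiftSeries (t * (n - i)) w)

/-- Conjugating S(T⁻¹ + v + wT) = T⁻¹S by T^{-m} and multiplying by P shows that passing from m to m
+ 1 multiplies P T^{-m} S T^m on the right by 1 + (T^{-m}v)T + (T^{-m}w)T². -/
theorem conv_shift_succ (hA : VanishBelow p A) (hB : VanishBelow s B)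
    (hs : IsInverseDressing t v w s) (m : ℕ) (n : ℤ) :
    conv t p (fun j => shift (-t * (m + 1)) (s j)) n
      = conv t p (fun j => shift (-t * m) (s j)) n
        + conv t p (fun j => shift (-t * m) (s j)) (n - 1)
          * ofSeries (shiftSeries (t * (n - 1 - m)) v)
        + conv t p (fun j => shift (-t * m) (s j)) (n - 2)
          * ofSeries (shiftSeries (t * (n - 2 - m)) w) := by
  have hB' : ∀ r : ℝ, VanishBelow (fun j => shift r (s j)) B := fun r k hk => by
    dsimp only
    rw [hB k hk, map_zero]
  rw [conv_eq_sum_Icc_of_le hA (hB' _) n le_rfl, conv_eq_sum_Icc_of_le hA (hB' _) n le_rfl,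
    conv_eq_sum_Icc_of_le hA (hB' _) (n - 1) (N := n - B) (by omega),
    conv_eq_sum_Icc_of_le hA (hB' _) (n - 2) (N := n - B) (by omega), sum_mul, sum_mul,
    ← sum_add_distrib, ← sum_add_distrib]
  refine sum_congr rfl fun i _ => ?_
  have e : shift (-t * (m + 1)) (s (n - i)) = shift (-t * m) (shift (-t) (s (n - i))) := by
    rw [shift_shift]
    congr 2
    ring
  have e1 : t * i + (-t * m + t * (((n - i : ℤ) : ℝ) - 1)) = t * (n - 1 - m) := by
    push_cast
    ring
  have e2 : t * i + (-t * m + t * (((n - i : ℤ) : ℝ) - 2)) = t * (n - 2 - m) := by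
    push_cast
    ring
  have e3 : n - i - 1 = n - 1 - i := by ring
  have e4 : n - i - 2 = n - 2 - i := by ring
  rw [e, hs]
  simp only [map_add, shift_mul, shift_shift, mul_add]
  rw [e1, e2, e3, e4, shift_ofSeries, shift_ofSeries, mul_assoc, mul_assoc]

/-- Both sides are the coefficients of (T⁻¹ + v + wT)^m T^m: they satisfy the same recurrence in m,
and for m = 0 both are the identity because PS = 1. -/
theorem conv_shift_eq (hA : VanishBelow p A) (hB : VanishBelow s B)
    (hps : conv t p s = Pi.single 0 1) (hs : IsInverseDressing t v w s)
    (ha : IsPowerCoeff t v w a) (m : ℕ) :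
    conv t p (fun j => shift (-t * m) (s j)) = extendZero fun n => ofSeries (a n m) := by
  induction m with
  | zero =>
    have : (fun j => shift (-t * (0 : ℕ)) (s j)) = s := funext fun j => by
      rw [Nat.cast_zero, mul_zero, shift_zero]
    rw [this, hps]
    funext n
    rcases lt_or_ge n 0 with h | h
    · rw [vanishBelow_extendZero _ n h, Pi.single_eq_of_ne h.ne]
    · lift n to ℕ using h
      rw [extendZero_natCast]
      rcases n with _ | _ | n
      · rw [ha.zero, ofSeries_one]
        rfl
      · rw [zero_add, ha.one, range_zero, sum_empty, ofSeries_zero,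
          Pi.single_eq_of_ne (by norm_num)]
      · rw [ha.add_two, range_zero, sum_empty, ofSeries_zero, Pi.single_eq_of_ne (by omega)]
  | succ m ih =>
    funext n
    rw [Nat.cast_succ, conv_shift_succ hA hB hs, ih]
    have hneg := vanishBelow_extendZero fun n => ofSeries (a n m)
    rcases lt_or_ge n 0 with h | h
    · rw [hneg n h, vanishBelow_extendZero _ n h, hneg _ (by omega), hneg _ (by omega)]
      simp
    · lift n to ℕ using h
      rw [extendZero_natCast, extendZero_natCast]
      rcases n with _ | _ | n
      · rw [hneg _ (by simp), hneg _ (by simp), ha.zero, ha.zero]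
        simp
      · rw [hneg (((0 + 1 : ℕ) : ℤ) - 2) (by simp)]
        have e : ((0 + 1 : ℕ) : ℤ) - 1 = (0 : ℕ) := by norm_num
        rw [e, extendZero_natCast, ha.zero, ofSeries_one, one_mul, zero_mul, add_zero, zero_add,
          ha.one, ha.one, sum_range_succ, ofSeries_add]
        simp
      · have e1 : ((n + 1 + 1 : ℕ) : ℤ) - 1 = (n + 1 : ℕ) := by push_cast; ring
        have e2 : ((n + 1 + 1 : ℕ) : ℤ) - 2 = n := by push_cast; ring
        have e3 : (((n + 1 + 1 : ℕ) : ℤ) : ℝ) - 1 - m = n + 1 - m := by push_cast; ring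
        have e4 : (((n + 1 + 1 : ℕ) : ℤ) : ℝ) - 2 - m = n - m := by push_cast; ring
        rw [e1, e2, e3, e4, extendZero_natCast, extendZero_natCast, ← ofSeries_mul, ← ofSeries_mul,
          ← ofSeries_add, ← ofSeries_add, ha.add_two, ha.add_two n (m + 1), sum_range_succ,
          add_assoc]

/-- The coefficients of `P (ε∂ₓ S) = -t⁻¹ d/dm (P T⁻ᵐ S Tᵐ)` at `m = 0`. -/
theorem conv_epsDx_eq (ht : t ≠ 0) (hA : VanishBelow p A) (hB : VanishBelow s B)
    (hps : conv t p s = Pi.single 0 1) (hs : IsInverseDressing t v w s)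
    (ha : IsPowerCoeff t v w a) {a' : ℕ → PowerSeries Smooth}
    (ha' : ∀ n, HasLinearPart (a n) (a' n)) :
    conv t p (fun j => -t • epsDxCoef (s j)) = extendZero fun n => ofSeries (a' n) := by
  have hB' : ∀ r : ℝ, VanishBelow (fun j => shift r (s j)) B := fun r k hk => by
    dsimp only
    rw [hB k hk, map_zero]
  have hB'' : VanishBelow (fun j => -t • epsDxCoef (s j)) B := fun k hk => by
    dsimp only
    rw [hB k hk, map_zero, smul_zero]
  have h : ∀ (n : ℤ) (m : ℕ), ∑ i ∈ Icc A (n - B), p i * shift (-t * m) (shift (t * i) (s (n - i)))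
      = extendZero (fun n => ofSeries (a n m)) n := by
    intro n m
    rw [← conv_shift_eq hA hB hps hs ha m, conv_eq_sum_Icc hA (hB' _)]
    refine sum_congr rfl fun i _ => ?_
    rw [shift_shift, shift_shift, add_comm]
  have hc : ∀ n, ∀ i ∈ Icc A (n - B), ConstExp (shift (t * i) (s (n - i))) := fun n i _ =>
    (hs.constExp ht hB _).shift _
  funext n
  rw [conv_eq_sum_Icc hA hB'']
  simp only [map_smul, ← epsDxCoef_shift]
  rcases lt_or_ge n 0 with hn | hn
  · rw [vanishBelow_extendZero _ n hn, ← ofSeries_zero]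
    refine sum_linearPart_coef (hasLinearPart_const 0) (hc n) fun m => ?_
    rw [h, vanishBelow_extendZero _ n hn, ofSeries_zero]
  · lift n to ℕ using hn
    rw [extendZero_natCast]
    refine sum_linearPart_coef (ha' n) (hc n) fun m => ?_
    rw [h, extendZero_natCast]

end

/-! ### The universal coefficients -/

/-- Coefficients of powers of the Lax operator: `sumOp` is summation over `range m`. -/
def powerCoeff (sumOp : PolyDiffRing → PolyDiffRing) (V W : ℕ → PolyDiffRing) : ℕ → PolyDiffRing
  | 0 => 1
  | 1 => sumOp (V 0)
  | n + 2 => sumOp (powerCoeff sumOp V W (n + 1) * V (n + 1) + powerCoeff sumOp V W n * W n)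

theorem evalRing_sum (v u : PowerSeries Smooth) {ι : Type*} (s : Finset ι) (f : ι → DiffRing) :
    evalRing v u (∑ i ∈ s, f i) = ∑ i ∈ s, evalRing v u (f i) := map_sum (evalRingHom v u) f s

theorem evalPoly_jet_v_zero (v u : PowerSeries Smooth) : evalPoly v u (jet (.v 0)) = v :=
  evalPoly_jet v u _

theorem evalPoly_jet_u_zero (v u : PowerSeries Smooth) : evalPoly v u (jet (.u 0)) = u :=
  evalPoly_jet v u _

/-- The recurrence uses only products, shifts by amounts affine in m, and summation over i < m, and
each of these preserves polynomial dependence on m. The offset c covers both w = e^u (c = 0) and w =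
Λe^u (t = c = 1). -/
theorem exists_isPowerCoeff (t c : ℝ) : ∃ a : ℕ → PolyDiffRing, ∀ v u,
    IsPowerCoeff t v (shiftSeries (t * c) (expSeries u))
      fun n m => evalRing v u (specialize m (a n)) := by
  -- The signs are chosen so that -t(m - n) = t(n - m), and in the next line -t(m - n - c) = t(n -
  -- m) + tc.
  choose V hV using fun n : ℕ => exists_specialize_eq_shiftSeries (jet (.v 0)) (-t) (-n)
  choose W hW using fun n : ℕ => exists_specialize_eq_shiftSeries (expJet 1) (-t) (-n - c)
  choose sumOp hsumOp using exists_specialize_eq_sum_range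
  refine ⟨powerCoeff sumOp V W, fun v u => ⟨fun m => ?_, fun m => ?_, fun n m => ?_⟩⟩
  · rw [powerCoeff, map_one, evalRing_one]
  · rw [powerCoeff, hsumOp, evalRing_sum]
    refine sum_congr rfl fun i _ => ?_
    rw [hV, evalPoly_jet_v_zero]
    congr 1
    push_cast
    ring
  · rw [powerCoeff, hsumOp, evalRing_sum]
    refine sum_congr rfl fun i _ => ?_
    rw [map_add, map_mul, map_mul, evalRing_add, evalRing_mul, evalRing_mul, hV, hW,
      evalPoly_jet_v_zero, evalPoly_expJet, one_smul, shiftSeries_shiftSeries]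
    congr 3
    · push_cast
      ring
    · ring

theorem HasLinearPart.add {F G : ℕ → PowerSeries Smooth} {F' G' : PowerSeries Smooth}
    (hF : HasLinearPart F F') (hG : HasLinearPart G G') :
    HasLinearPart (fun m => F m + G m) (F' + G') := by
  intro n x
  obtain ⟨q, hq, hq'⟩ := hF n x
  obtain ⟨r, hr, hr'⟩ := hG n x
  refine ⟨q + r, fun m => ?_, ?_⟩
  · rw [map_add, map_add, hq, hr, Polynomial.eval_add]
  · rw [map_add, map_add, hq', hr', Polynomial.coeff_add]

/-- If `(1 - Λ⁻¹) ℓ = ε u`, then `∂ₓ ℓ` is given by a universal differential polynomial in `u`. -/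
theorem exists_dxSeries_eq_evalRing : ∃ b : DiffRing, ∀ v u ℓ,
    shiftSeries 1 ℓ - ℓ = X * shiftSeries 1 u → dxSeries ℓ = evalRing v u b := by
  obtain ⟨U, hU⟩ := exists_specialize_eq_shiftSeries (jet (.u 0)) (-1) 0
  obtain ⟨b, hb⟩ := exists_specialize_eq_sum_range U
  refine ⟨linearPart b, fun v u ℓ hℓ => ?_⟩
  have hb' : ∀ m, evalRing v u (specialize m b) = ∑ i ∈ range m, shiftSeries (-1 * i) u := by
    intro m
    rw [hb, evalRing_sum]
    refine sum_congr rfl fun i _ => ?_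
    rw [hU, evalPoly_jet_u_zero, add_zero]
  -- Telescoping: ℓ = Λ^{-m}ℓ + ε∑Λ^{-i}u over i < m. The sum is independent of m, so its linear
  -- part -ε∂ₓℓ + εb is zero.
  have hsum : ∀ m : ℕ, shiftSeries (-1 * m) ℓ + X * evalRing v u (specialize m b) = ℓ := by
    intro m
    rw [hb']
    induction m with
    | zero => simp [shiftSeries_zero]
    | succ m ih =>
      have h := congrArg (shiftSeries (-1 * (m + 1))) hℓ
      rw [shiftSeries_sub, shiftSeries_X_mul, shiftSeries_shiftSeries, shiftSeries_shiftSeries,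
        show (-1 * (m + 1) + 1 : ℝ) = -1 * m by ring] at h
      rw [sum_range_succ, mul_add, ← h, Nat.cast_succ]
      linear_combination ih
  have h1 := (hasLinearPart_shiftSeries (-1) ℓ).add
    ((hasLinearPart_evalRing_specialize v u b).const_mul X)
  simp only [hsum] at h1
  have h2 := h1.unique (hasLinearPart_const ℓ)
  apply X_mul_injective
  rw [neg_smul, one_smul, neg_add_eq_zero] at h2
  exact h2

/-- If `Λ q = e^{Λ u} q`, then `q / Λⁿ q` is given by a universal differential polynomial. -/
theorem exists_mul_shift_eq_evalRing : ∃ r : ℕ → DiffRing, ∀ v u (q q' : Coef), q * q' = 1 →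
    shift 1 q = ofSeries (shiftSeries 1 (expSeries u)) * q →
    ∀ n : ℕ, q * shift n q' = ofSeries (evalRing v u (r n)) := by
  obtain ⟨V, hV⟩ := exists_specialize_eq_shiftSeries (expJet (-1)) 1 0
  -- q/Λⁿq is the product of Λ^{i-1}q/Λⁱq = e^{-Λⁱu} over 1 ≤ i ≤ n; the index i + 1 makes the
  -- product start at Λ¹.
  refine ⟨fun n => ∏ i ∈ range n, specialize (i + 1) V, fun v u q q' hqq hq n => ?_⟩
  have h1 : q * shift 1 q' = ofSeries (shiftSeries 1 (expSeries (-u))) := by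
    have e : ofSeries (shiftSeries 1 (expSeries (-u))) * ofSeries (shiftSeries 1 (expSeries u))
        = 1 := by
      rw [← ofSeries_mul, ← shiftSeries_mul, mul_comm, expSeries_mul_neg, shiftSeries_one,
        ofSeries_one]
    calc q * shift 1 q' = ofSeries (shiftSeries 1 (expSeries (-u)))
          * (ofSeries (shiftSeries 1 (expSeries u)) * q) * shift 1 q' := by
            rw [← mul_assoc, e, one_mul]
      _ = _ := by rw [← hq, mul_assoc, shift_mul_shift_eq_one hqq, mul_one]
  dsimp only
  induction n with
  | zero => rw [Nat.cast_zero, shift_zero, hqq, range_zero, prod_empty, evalRing_one, ofSeries_one]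
  | succ n ih =>
    have e : q * shift ((n + 1 : ℕ) : ℝ) q' = q * shift n q' * shift n (q * shift 1 q') := by
      rw [shift_mul, shift_shift, mul_assoc, ← mul_assoc (shift n q'), mul_comm (shift n q'),
        shift_mul_shift_eq_one hqq, one_mul, Nat.cast_succ]
    rw [e, ih, h1, prod_range_succ, evalRing_mul, ofSeries_mul, shift_ofSeries,
      shiftSeries_shiftSeries, hV, evalPoly_expJet, neg_smul, one_smul]
    congr 3
    push_cast
    ring

/-! ### Inverses of dressing operators -/

/-- SP = 1 cancels P in S(P e S). With e = T⁻¹ this yields a recurrence for the inverse series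
alone. -/
theorem conv_left_inverse {t : ℝ} {p s e L : ℤ → Coef} {A B D : ℤ} (hp : VanishBelow p A)
    (hs : VanishBelow s B) (he : VanishBelow e D) (hsp : conv t s p = Pi.single 0 1)
    (hL : conv t (conv t p e) s = L) : conv t s L = conv t e s := by
  rw [← hL, ← conv_assoc hs (hp.conv he) hs, ← conv_assoc hs hp he, hsp, one_conv]

/-- In x(PS)y the function y passes Λ^{tn} and becomes its shift. This transfers identities between
Q and Q stripped of its exponential factor. -/
theorem conv_twist (t : ℝ) (p s : ℤ → Coef) (x y : Coef) (n : ℤ) {A B : ℤ}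
    (hp : VanishBelow p A) (hs : VanishBelow s B) :
    conv t (fun i => x * p i) (fun j => s j * shift (t * j) y) n
      = x * shift (t * n) y * conv t p s n := by
  have hp' : VanishBelow (fun i => x * p i) A := fun k hk => by
    dsimp only
    rw [hp k hk, mul_zero]
  have hs' : VanishBelow (fun j => s j * shift (t * j) y) B := fun k hk => by
    dsimp only
    rw [hs k hk, zero_mul]
  rw [conv_eq_sum_Icc hp' hs', conv_eq_sum_Icc hp hs, mul_sum]
  refine sum_congr rfl fun i _ => ?_
  have e : t * i + t * ((n - i : ℤ) : ℝ) = t * n := by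
    push_cast
    ring
  rw [shift_mul, shift_shift, e]
  ring

variable {v u : PowerSeries Smooth}

theorem exists_vanishBelow_reflect {a : ℤ → Coef} (h : BddAbove (Function.support a)) :
    ∃ B, VanishBelow (reflect a) B := by
  obtain ⟨N, hN⟩ := h
  refine ⟨-N, fun k hk => ?_⟩
  by_contra h
  have := hN (show -k ∈ Function.support a from h)
  omega

theorem exists_vanishBelow {a : ℤ → Coef} (h : BddBelow (Function.support a)) :
    ∃ B, VanishBelow a B := by
  obtain ⟨N, hN⟩ := h
  refine ⟨N, fun k hk => ?_⟩
  by_contra h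
  have := hN (show k ∈ Function.support a from h)
  omega

theorem conv_eq_of_opMul {a b : ℤ → Coef} (h : opMul (opOf a) (opOf b) = lam 0) :
    conv 1 a b = Pi.single 0 1 := by
  rw [opMul_opOf, lam_eq_opOf] at h
  exact opOf_injective h

/-- `P (ε∂ₓ P⁻¹)` is given by universal differential polynomials. -/
theorem exists_conv_P_eq : ∃ h : ℕ → DiffRing, ∀ v u (D : Dressing v u),
    conv 1 D.P (fun j => epsDxCoef (D.Pinv j))
      = reflect (extendZero fun k => ofSeries (evalRing v u (h k))) := by
  obtain ⟨a, ha⟩ := exists_isPowerCoeff (-1) 0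
  refine ⟨fun k => linearPart (a k), fun v u D => ?_⟩
  have hp : VanishBelow (reflect D.P) 0 := fun k hk => D.P_pos _ (by omega)
  obtain ⟨B, hs⟩ := exists_vanishBelow_reflect D.Pinv_bdd
  have hps : conv (-1) (reflect D.P) (reflect D.Pinv) = Pi.single 0 1 := by
    rw [← reflect_conv, conv_eq_of_opMul D.P_mul_inv, reflect_single, neg_zero]
  have hsp : conv (-1) (reflect D.Pinv) (reflect D.P) = Pi.single 0 1 := by
    rw [← reflect_conv, conv_eq_of_opMul D.P_inv_mul, reflect_single, neg_zero]
  have hL : conv (-1) (conv (-1) (reflect D.P) (Pi.single (-1) 1)) (reflect D.Pinv)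
      = laxSeq 1 (ofSeries v) (ofSeries (expSeries u)) := by
    have h := D.lax_eq_P
    rw [lam_eq_opOf, opMul_opOf, opMul_opOf, lax_eq_opOf] at h
    rw [← reflect_laxSeq, opOf_injective h, reflect_conv, reflect_conv, reflect_single]
  have hinv : IsInverseDressing (-1) v (expSeries u) (reflect D.Pinv) := by
    intro k
    have h := congrFun (conv_left_inverse hp hs (vanishBelow_single _ _) hsp hL) (k - 1)
    rw [conv_laxSeq hs, conv_single_left, shift_one, one_mul, mul_one] at h
    have e1 : k - 1 - -1 = k := by ring
    have e2 : k - 1 + 1 = k := by ring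
    have e3 : k - 1 - 1 = k - 2 := by ring
    rw [e1, e2, e3] at h
    push_cast at h
    rw [show (-1 : ℝ) * -1 = - -1 by norm_num,
      show (-1 : ℝ) * ((k : ℝ) - 1 - 1) = -1 * (k - 2) by ring] at h
    exact h.symm
  have ha' := ha v u
  rw [mul_zero, shiftSeries_zero] at ha'
  have key := conv_epsDx_eq (by norm_num) hp hs hps hinv ha'
    fun n => hasLinearPart_evalRing_specialize v u (a n)
  rw [← key, reflect_conv, reflect_reflect]
  simp only [neg_neg, one_smul]
  congr 1
  funext j
  rw [reflect, reflect, neg_neg]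

/-- `Q (ε∂ₓ Q⁻¹)` is given by universal differential polynomials. -/
theorem exists_conv_Q_eq : ∃ h : ℕ → DiffRing, ∀ v u (D : Dressing v u),
    ∀ n, conv 1 D.Q (fun j => epsDxCoef (D.Qinv j)) n
      = -extendZero (fun k => ofSeries (evalRing v u (h k))) n := by
  obtain ⟨a, ha⟩ := exists_isPowerCoeff 1 1
  obtain ⟨b, hb⟩ := exists_dxSeries_eq_evalRing
  obtain ⟨r, hr⟩ := exists_mul_shift_eq_evalRing
  -- With Q = qp and Q⁻¹ = sq⁻¹, the Leibniz rule gives Q(ε∂ₓQ⁻¹) = q[p(ε∂ₓs)]q⁻¹ + q ε∂ₓ(q⁻¹). The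
  -- first term carries q/Λᵏq = r k in degree k; the second has degree 0 only and equals -b.
  refine ⟨fun k => r k * linearPart (a k) + if k = 0 then b else 0, fun v u D n => ?_⟩
  obtain ⟨q, q', ℓ, hqq, hq, hdq, hℓ⟩ := exists_exponential_solution u
  have hQ : VanishBelow D.Q 0 := D.Q_neg
  obtain ⟨B, hQinv⟩ := exists_vanishBelow D.Qinv_bdd
  have hQQ := conv_eq_of_opMul D.Q_mul_inv
  have hQQ' := conv_eq_of_opMul D.Q_inv_mul
  have hL : conv 1 (conv 1 D.Q (Pi.single (-1) 1)) D.Qinv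
      = laxSeq (ofSeries (expSeries u)) (ofSeries v) 1 := by
    have h := D.lax_eq_Q
    rw [lam_eq_opOf, opMul_opOf, opMul_opOf, lax_eq_opOf] at h
    exact (opOf_injective h).symm
  set p : ℤ → Coef := fun i => q' * D.Q i with hp_def
  set s : ℤ → Coef := fun j => D.Qinv j * shift (1 * j) q with hs_def
  have hp : VanishBelow p 0 := fun k hk => by rw [hp_def]; dsimp only; rw [hQ k hk, mul_zero]
  have hs : VanishBelow s B := fun k hk => by rw [hs_def]; dsimp only; rw [hQinv k hk, zero_mul]
  have hQp : D.Q = fun i => q * p i := funext fun i => by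
    rw [hp_def]
    dsimp only
    rw [← mul_assoc, hqq, one_mul]
  have hQs : D.Qinv = fun j => s j * shift (1 * j) q' := funext fun j => by
    rw [hs_def]
    dsimp only
    rw [mul_assoc, shift_mul_shift_eq_one hqq, mul_one]
  have hps : conv 1 p s = Pi.single 0 1 := by
    funext n
    rw [hp_def, hs_def, conv_twist 1 D.Q D.Qinv q' q n hQ hQinv, hQQ]
    rcases eq_or_ne n 0 with rfl | hn
    · rw [Pi.single_eq_same, Int.cast_zero, mul_zero, shift_zero, mul_comm q', hqq, mul_one]
    · rw [Pi.single_eq_of_ne hn, mul_zero]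
  -- Multiplying the recurrence for Q⁻¹ by the shifted q absorbs the factor e^u, and Λq = e^{Λu}q
  -- moves it to the other end as w = Λe^u.
  have hinv : IsInverseDressing 1 v (shiftSeries 1 (expSeries u)) s := by
    intro k
    have h := congrFun (conv_left_inverse hQ hQinv (vanishBelow_single _ _) hQQ' hL) (k - 1)
    rw [conv_laxSeq hQinv, conv_single_left, shift_one, one_mul, mul_one] at h
    have e1 : k - 1 - -1 = k := by ring
    have e2 : k - 1 + 1 = k := by ring
    have e3 : k - 1 - 1 = k - 2 := by ring
    rw [e1, e2, e3] at h
    push_cast at h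
    have f1 : shift (1 * (k : ℝ)) (ofSeries (expSeries u)) * shift (k - 1) q = shift (1 * k) q := by
      have := congrArg (shift (k : ℝ)) (shift_neg_one_of_shift_one hq)
      rw [shift_mul, shift_shift, ← sub_eq_add_neg] at this
      rw [one_mul]
      exact this
    have f2 : shift (1 * ((k : ℝ) - 2)) (ofSeries (shiftSeries 1 (expSeries u)))
        * shift (1 * (k - 2)) q = shift (k - 1) q := by
      rw [← shift_mul, ← hq, shift_shift]
      congr 2
      ring
    have f3 : shift (-1) (shift (1 * (k : ℝ)) q) = shift (k - 1) q := by
      rw [shift_shift]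
      congr 2
      ring
    have f4 : (1 : ℝ) * -1 = -1 := by norm_num
    have f5 : (k : ℝ) - 1 + 1 = k := by ring
    rw [f4, f5] at h
    rw [hs_def]
    dsimp only
    push_cast
    rw [shift_mul, f3]
    simp only [one_mul] at h f1 f2 ⊢
    linear_combination (-shift ((k : ℝ) - 1) q) * h + D.Qinv k * f1 - D.Qinv (k - 2) * f2
  have ha' := ha v u
  rw [mul_one] at ha'
  have key := conv_epsDx_eq one_ne_zero hp hs hps hinv ha'
    fun n => hasLinearPart_evalRing_specialize v u (a n)
  have hqd : q * epsDxCoef q' = -ofSeries (evalRing v u b) := by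
    have h1 : epsDxCoef (1 : Coef) = 0 := by
      have := epsDxCoef_mul 1 1
      simpa using this
    have h2 := epsDxCoef_mul q q'
    rw [hqq, h1, hdq, hb v u ℓ hℓ, mul_assoc, hqq, mul_one] at h2
    rw [eq_neg_iff_add_eq_zero, add_comm, ← h2]
  have hes : VanishBelow (fun j => epsDxCoef (s j)) B := fun k hk => by
    dsimp only
    rw [hs k hk, map_zero]
  have key' : ∀ n, conv 1 p (fun j => epsDxCoef (s j)) n
      = -extendZero (fun n => ofSeries (evalRing v u (linearPart (a n)))) n := by
    intro n
    have hes' : VanishBelow (fun j => (-1 : ℝ) • epsDxCoef (s j)) B := fun k hk => by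
      dsimp only
      rw [hs k hk, map_zero, smul_zero]
    rw [← key, conv_eq_sum_Icc hp hes, conv_eq_sum_Icc hp hes', ← sum_neg_distrib]
    refine sum_congr rfl fun i _ => ?_
    rw [map_smul, mul_smul_comm, neg_smul, one_smul, neg_neg]
  have hsplit : (fun j => epsDxCoef (D.Qinv j))
      = (fun j => epsDxCoef (s j) * shift (1 * j) q')
        + fun j => s j * shift (1 * j) (epsDxCoef q') := by
    funext j
    rw [hQs]
    simp only [Pi.add_apply, epsDxCoef_mul, epsDxCoef_shift]
  have v1 : VanishBelow (fun j => epsDxCoef (s j) * shift (1 * j) q') B := fun k hk => by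
    dsimp only
    rw [hs k hk, map_zero, zero_mul]
  have v2 : VanishBelow (fun j => s j * shift (1 * j) (epsDxCoef q')) B := fun k hk => by
    dsimp only
    rw [hs k hk, zero_mul]
  rw [hsplit, conv_add hQ v1 v2, Pi.add_apply, hQp, conv_twist 1 p _ q q' n hp hes,
    conv_twist 1 p s q _ n hp hs, key', hps]
  rcases lt_or_ge n 0 with hn | hn
  · rw [vanishBelow_extendZero _ n hn, vanishBelow_extendZero _ n hn, Pi.single_eq_of_ne hn.ne]
    simp
  · lift n to ℕ using hn
    rw [extendZero_natCast, extendZero_natCast, one_mul, Int.cast_natCast,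
      hr v u q q' hqq hq, evalRing_add, evalRing_mul, ofSeries_add, ofSeries_mul]
    rcases eq_or_ne n 0 with rfl | hn
    · rw [if_pos rfl, Nat.cast_zero, shift_zero, hqd, Nat.cast_zero, Pi.single_eq_same]
      ring
    · rw [if_neg hn, Pi.single_eq_of_ne (by exact_mod_cast hn), evalRing_zero, ofSeries_zero]
      ring

/-! ### The logarithm -/

theorem epsDx_zero : epsDx 0 = epsDxCoef := Pi.single_eq_same _ _

theorem shift_mul_epsDxCoef (t : ℝ) : shift t * epsDxCoef = epsDxCoef * shift t :=
  LinearMap.ext fun x => by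
    rw [Module.End.mul_apply, Module.End.mul_apply, epsDxCoef_shift]

theorem opMul_epsDx (a : ℤ → Coef) (i : ℤ) :
    opMul (opOf a) epsDx i = mulOp (a i) * epsDxCoef := by
  rw [opMul, finsum_eq_single _ i]
  · rw [sub_self, epsDx_zero]
    rw [shift_mul_epsDxCoef, mul_assoc, shift_mul_shift_neg, mul_one]
    rfl
  · intro j hj
    have : epsDx (i - j) = 0 := Pi.single_eq_of_ne (by omega) _
    rw [this, mul_zero, zero_mul, mul_zero]

/-- The Leibniz rule ε∂ₓ ∘ f = f ε∂ₓ + (ε∂ₓf) in every term. Finiteness is needed to split the sum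
in two. -/
theorem opMul_opMul_epsDx {a b : ℤ → Coef} {n : ℤ}
    (h : {i : ℤ | a i ≠ 0 ∧ b (n - i) ≠ 0}.Finite) :
    opMul (opMul (opOf a) epsDx) (opOf b) n = mulOp (conv 1 a b n) * epsDxCoef
      + mulOp (conv 1 a (fun j => epsDxCoef (b j)) n) := by
  have h0 : ∀ i ∉ h.toFinset, a i = 0 ∨ b (n - i) = 0 := by
    intro i hi
    rw [Set.Finite.mem_toFinset, Set.mem_ofPred_eq, not_and_or, not_not, not_not] at hi
    exact hi
  have e1 : conv 1 a b n = ∑ i ∈ h.toFinset, a i * shift (1 * i) (b (n - i)) := by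
    refine finsum_eq_sum_of_support_subset _ fun i hi => ?_
    by_contra hi'
    rcases h0 i hi' with h | h <;> simp [h] at hi
  have e2 : conv 1 a (fun j => epsDxCoef (b j)) n
      = ∑ i ∈ h.toFinset, a i * shift (1 * i) (epsDxCoef (b (n - i))) := by
    refine finsum_eq_sum_of_support_subset _ fun i hi => ?_
    by_contra hi'
    rcases h0 i hi' with h | h <;> simp [h] at hi
  have e3 : ∀ i, opMul (opOf a) epsDx i * (shift i * opOf b (n - i) * shift (-i))
      = mulOp (a i * shift (1 * i) (b (n - i))) * epsDxCoef
        + mulOp (a i * shift (1 * i) (epsDxCoef (b (n - i)))) := by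
    intro i
    rw [opMul_epsDx, opOf, shift_mul_mulOp, mul_assoc (mulOp _) (shift _), shift_mul_shift_neg,
      mul_one, mulOp_mul, mulOp_mul, one_mul, mul_assoc, mul_assoc, ← mul_add, ← epsDxCoef_shift]
    congr 1
    exact LinearMap.ext fun x => (epsDxCoef_mul _ _).trans (add_comm _ _)
  have e4 : ∀ f : ℤ → Coef, mulOp (∑ i ∈ h.toFinset, f i) = ∑ i ∈ h.toFinset, mulOp (f i) :=
    fun f => map_sum mulOpHom f _
  rw [e1, e2, e4, e4, sum_mul, ← sum_add_distrib, opMul]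
  simp only [e3]
  refine finsum_eq_sum_of_support_subset _ fun i hi => ?_
  by_contra hi'
  rcases h0 i hi' with h | h <;> simp [h, mulOp_zero] at hi

/-- The operators multiplying ε∂ₓ are PP⁻¹ = 1 and QQ⁻¹ = 1, so they cancel and a multiplication
operator remains. -/
theorem Dressing.log_apply (D : Dressing v u) (n : ℤ) :
    D.log n = mulOp ((1 / 2 : ℝ) • (conv 1 D.P (fun j => epsDxCoef (D.Pinv j)) n
      - conv 1 D.Q (fun j => epsDxCoef (D.Qinv j)) n)) := by
  have hP : {i : ℤ | D.P i ≠ 0 ∧ D.Pinv (n - i) ≠ 0}.Finite := by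
    obtain ⟨N, hN⟩ := D.Pinv_bdd
    refine (Set.finite_Icc (n - N) 0).subset fun i hi => ⟨?_, ?_⟩
    · have := hN hi.2
      omega
    · by_contra h
      exact hi.1 (D.P_pos i (by omega))
  have hQ : {i : ℤ | D.Q i ≠ 0 ∧ D.Qinv (n - i) ≠ 0}.Finite := by
    obtain ⟨N, hN⟩ := D.Qinv_bdd
    refine (Set.finite_Icc 0 (n - N)).subset fun i hi => ⟨?_, ?_⟩
    · by_contra h
      exact hi.1 (D.Q_neg i (by omega))
    · have := hN hi.2
      omega
  have hsmul : ∀ x y : Coef, mulOp ((1 / 2 : ℝ) • (x - y)) = (1 / 2 : ℝ) • (mulOp x - mulOp y) :=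
    fun x y => LinearMap.ext fun z => by
      change ((1 / 2 : ℝ) • (x - y)) * z = (1 / 2 : ℝ) • (x * z - y * z)
      rw [smul_mul_assoc, sub_mul]
  rw [hsmul]
  change (1 / 2 : ℝ) • (opMul (opMul (opOf D.P) epsDx) (opOf D.Pinv) n
    - opMul (opMul (opOf D.Q) epsDx) (opOf D.Qinv) n) = _
  rw [opMul_opMul_epsDx hP, opMul_opMul_epsDx hQ, conv_eq_of_opMul D.P_mul_inv,
    conv_eq_of_opMul D.Q_mul_inv]
  have hsub : ∀ X Y Z : Module.End ℝ Coef, X + Y - (X + Z) = Y - Z := fun X Y Z => by abel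
  rw [hsub]

theorem exists_log_eq : ∃ g : ℤ → DiffRing, ∀ (v u : PowerSeries Smooth) (D : Dressing v u) (k : ℤ),
    D.log k = mulOp (ofSeries (evalRing v u (g k))) := by
  obtain ⟨a, ha⟩ := exists_conv_P_eq
  obtain ⟨b, hb⟩ := exists_conv_Q_eq
  -- P contributes in degrees k ≤ 0 and Q in degrees k ≥ 0, both at k = 0. They are added because
  -- the Q-part was computed with a minus sign.
  refine ⟨fun k => C (const (1 / 2)) * ((if 0 ≤ -k then a (-k).toNat else 0)
    + if 0 ≤ k then b k.toNat else 0), fun v u D k => ?_⟩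
  have hite : ∀ (c : ℕ → DiffRing) (k : ℤ), extendZero (fun k => ofSeries (evalRing v u (c k))) k
      = ofSeries (evalRing v u (if 0 ≤ k then c k.toNat else 0)) := by
    intro c k
    rw [extendZero]
    split_ifs
    · rfl
    · rw [evalRing_zero, ofSeries_zero]
  have hhalf : ∀ f : DiffRing, ofSeries (evalRing v u (C (const (1 / 2)) * f))
      = (1 / 2 : ℝ) • ofSeries (evalRing v u f) := by
    intro f
    have e : evalPoly v u (const (1 / 2)) = (1 / 2 : ℝ) • 1 := by
      rw [← mul_one (const _), evalPoly_const_mul, evalPoly_one]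
    rw [evalRing_mul, evalRing_C, e, smul_mul_assoc, one_mul, ofSeries, ofLaurent, toLaurent_smul]
    exact (AddMonoidAlgebra.smul_single _ _ _).symm
  rw [D.log_apply, ha, hb, hhalf, reflect, hite, hite, sub_neg_eq_add, ← ofSeries_add,
    ← evalRing_add]

end Toda

end

theorem theorem2p1 :
    (∀ v u : PowerSeries Toda.Smooth, Nonempty (Toda.Dressing v u)) ∧
    (∀ (v u : PowerSeries Toda.Smooth) (D D' : Toda.Dressing v u), D.log = D'.log) ∧
    (∃ g : ℤ → Toda.DiffRing,
      ∀ (v u : PowerSeries Toda.Smooth) (D : Toda.Dressing v u) (k : ℤ),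
        D.log k = Toda.mulOp (Toda.ofSeries (Toda.evalRing v u (g k)))) := by
  obtain ⟨g, hg⟩ := Toda.exists_log_eq
  exact ⟨Toda.exists_dressing, fun v u D D' => funext fun k => by rw [hg, hg], g, hg⟩
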